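/- **Setting.** For a real matrix $A\in\mathbb R^{n\times m}$ of rank $n$ with columns $y_1,\dots,y_m$, let $Z_A=\sum_{j=1}^m[0,y_j]\subset\mathbb R^n$ be its zonotope (Minkowski sum). For a facet $H$ of $Z_A$ with (nonzero) normal vector $\eta_H$, let $m(H)$ be the number of nonzero coordinates of $\eta_H A\in\mathbb R^m$. The external zonotopal algebra of $A$ is $$\mathcal C_A^{\mathrm{Ex}}=\mathbb R[x_1,\dots,x_n]\big/\big\langle (\eta_H\cdot(x_1,\dots,x_n))^{m(H)+1} : H \text{ a facet of } Z_A\big\rangle ,$$ graded by polynomial degree. The matroid $M_A$ has ground set $\{1,\dots,m\}$, a set being independent if the columns it indexes are linearly independent. Matrices $A_1\in\mathbb R^{n_1\times m_1}$ and $A_2\in\mathbb R^{n_2\times m_2}$ are z-equivalent if $m_1=m_2$ and the row space of $A_1$ is obtained from that of $A_2$ by permuting the coordinates and then multiplying each coordinate by a nonzero real number. A matrix $A\in\mathbb R^{n\times m}$ is unimodular if all its $n\times n$ minors lie in $\{0,1,-1\}$, and totally unimodular if all its minors of all sizes do; every totally unimodular matrix is unimodular. A matroid is regular if it is isomorphic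 to $M_B$ for some totally unimodular real matrix $B$ (of any finite size and rank). **Theorem.** (a) Let $A_1\in\mathbb R^{n_1\times m_1}$ and $A_2\in\mathbb R^{n_2\times m_2}$ be unimodular (for instance totally unimodular) matrices of rank $n_1$ and $n_2$ respectively, without zero columns. Then the following are equivalent: 1. $\mathcal C_{A_1}^{\mathrm{Ex}}$ and $\mathcal C_{A_2}^{\mathrm{Ex}}$ are isomorphic as (non-graded) $\mathbb R$-algebras; 2. $\mathcal C_{A_1}^{\mathrm{Ex}}$ and $\mathcal C_{A_2}^{\mathrm{Ex}}$ are isomorphic as graded $\mathbb R$-algebras; 3. $A_1$ and $A_2$ are z-equivalent; 4. the matroids $M_{A_1}$ and $M_{A_2}$ are isomorphic. (b) For every unimodular matrix $A$ of full row rank without zero columns, $M_A$ is a regular matroid without loops; and every regular matroid without loops is isomorphic to $M_A$ for some totally unimodular matrix $A$ of full row rank without zero columns. Hence $\mathcal C_A^{\mathrm{Ex}}\mapsto M_A$ induces a bijection between the isomorphism classes of the external zonotopal algebras of unimodular matrices of full row rank without zero columns and the isomorphism classes of regular matroids without loops. -/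

import Mathlib

open scoped Pointwise

noncomputable section

namespace Zonotopal

/-- An `n × m` real matrix is unimodular if each of its `n × n` minors is `0`, `1` or `-1`.
Every totally unimodular matrix (all minors of all sizes in `{0, 1, -1}`) is unimodular. -/
def IsUnimodular {n m : ℕ} (A : Matrix (Fin n) (Fin m) ℝ) : Prop :=
  ∀ g : Fin n → Fin m, (A.submatrix id g).det ∈ Set.range (SignType.cast : SignType → ℝ)

/-- The zonotope of `A`: the Minkowski sum of the segments `[0, y]`, `y` a column of `A`. -/
def zonotope {n m : ℕ} (A : Matrix (Fin n) (Fin m) ℝ) : Set (Fin n → ℝ) :=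
  ∑ j : Fin m, segment ℝ (0 : Fin n → ℝ) (A.col j)

/-- `F` is a facet of the polytope `Z`: a nonempty (exposed) face whose dimension is one less
than the dimension of `Z`. -/
def IsFacet {n : ℕ} (Z F : Set (Fin n → ℝ)) : Prop :=
  F.Nonempty ∧ IsExposed ℝ Z F ∧
    Module.finrank ℝ (vectorSpan ℝ F) + 1 = Module.finrank ℝ (vectorSpan ℝ Z)

/-- `η` is a (nonzero) normal vector of the set `F`. -/
def IsNormal {n : ℕ} (F : Set (Fin n → ℝ)) (η : Fin n → ℝ) : Prop :=
  η ≠ 0 ∧ ∀ x ∈ F, ∀ y ∈ F, η ⬝ᵥ x = η ⬝ᵥ y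

/-- The number of nonzero coordinates of the row vector `η A`. -/
def weight {n m : ℕ} (A : Matrix (Fin n) (Fin m) ℝ) (η : Fin n → ℝ) : ℕ :=
  {j : Fin m | Matrix.vecMul η A j ≠ 0}.ncard

/-- The linear form `η · (x₁, …, xₙ)`. -/
def linForm {n : ℕ} (η : Fin n → ℝ) : MvPolynomial (Fin n) ℝ :=
  ∑ i, MvPolynomial.C (η i) * MvPolynomial.X i

/-- The external zonotopal ideal of `A`, generated by `(η_H · x) ^ (m(H) + 1)` where `H` runs over
the facets of the zonotope and `η_H` is a normal of `H`. (A normal of a facet is unique up to a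
nonzero factor if `A` has full row rank, so that using all normals gives the same ideal as using
one normal for each facet.) -/
def externalIdeal {n m : ℕ} (A : Matrix (Fin n) (Fin m) ℝ) : Ideal (MvPolynomial (Fin n) ℝ) :=
  Ideal.span {p | ∃ (F : Set (Fin n → ℝ)) (η : Fin n → ℝ),
    IsFacet (zonotope A) F ∧ IsNormal F η ∧ p = linForm η ^ (weight A η + 1)}

/-- The external zonotopal algebra of `A`. -/
abbrev ExternalAlgebra {n m : ℕ} (A : Matrix (Fin n) (Fin m) ℝ) : Type :=
  MvPolynomial (Fin n) ℝ ⧸ externalIdeal A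

/-- The component of degree `d` of the external algebra: the classes of the homogeneous
polynomials of degree `d`. -/
def gradedPiece {n m : ℕ} (A : Matrix (Fin n) (Fin m) ℝ) (d : ℕ) :
    Submodule ℝ (ExternalAlgebra A) :=
  (MvPolynomial.homogeneousSubmodule (Fin n) ℝ d).map
    (Ideal.Quotient.mkₐ ℝ (externalIdeal A)).toLinearMap

/-- The external algebras are isomorphic as (ungraded) real algebras. -/
def AlgebraIso {n₁ m₁ n₂ m₂ : ℕ}
    (A₁ : Matrix (Fin n₁) (Fin m₁) ℝ) (A₂ : Matrix (Fin n₂) (Fin m₂) ℝ) : Prop :=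
  Nonempty (ExternalAlgebra A₁ ≃ₐ[ℝ] ExternalAlgebra A₂)

/-- The external algebras are isomorphic as graded real algebras. -/
def GradedAlgebraIso {n₁ m₁ n₂ m₂ : ℕ}
    (A₁ : Matrix (Fin n₁) (Fin m₁) ℝ) (A₂ : Matrix (Fin n₂) (Fin m₂) ℝ) : Prop :=
  ∃ e : ExternalAlgebra A₁ ≃ₐ[ℝ] ExternalAlgebra A₂,
    ∀ d : ℕ, (gradedPiece A₁ d).map e.toLinearMap = gradedPiece A₂ d

/-- `V₁ ⊆ ℝ^{m₁}` and `V₂ ⊆ ℝ^{m₂}` are z-equivalent: `V₁` is obtained from `V₂` by permuting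
the coordinates and then rescaling each of them by a nonzero factor (`m₁ = m₂` is forced by the
bijection of the coordinates). -/
def ZEquivSubspaces {m₁ m₂ : ℕ}
    (V₁ : Submodule ℝ (Fin m₁ → ℝ)) (V₂ : Submodule ℝ (Fin m₂ → ℝ)) : Prop :=
  ∃ (σ : Fin m₁ ≃ Fin m₂) (d : Fin m₁ → ℝ), (∀ j, d j ≠ 0) ∧
    ∀ v : Fin m₁ → ℝ, v ∈ V₁ ↔ ∃ w ∈ V₂, ∀ j, v j = w (σ j) * d j

/-- Two matrices are z-equivalent if their row spaces are. -/
def ZEquiv {n₁ m₁ n₂ m₂ : ℕ}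
    (A₁ : Matrix (Fin n₁) (Fin m₁) ℝ) (A₂ : Matrix (Fin n₂) (Fin m₂) ℝ) : Prop :=
  ZEquivSubspaces (Submodule.span ℝ (Set.range A₁.row)) (Submodule.span ℝ (Set.range A₂.row))

/-- Augmentation for linearly independent sets of columns. -/
theorem columns_aug {n m : ℕ} (A : Matrix (Fin n) (Fin m) ℝ) ⦃I J : Set (Fin m)⦄
    (hI : LinearIndepOn ℝ A.col I) (hJ : LinearIndepOn ℝ A.col J) (hIJ : I.ncard < J.ncard) :
    ∃ e ∈ J, e ∉ I ∧ LinearIndepOn ℝ A.col (insert e I) := by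
  classical
  by_contra! hcon
  have hsub : A.col '' J ⊆ Submodule.span ℝ (A.col '' I) := by
    rintro _ ⟨e, heJ, rfl⟩
    by_contra hne
    by_cases heI : e ∈ I
    · exact hne (Submodule.subset_span ⟨e, heI, rfl⟩)
    · exact hcon e heJ heI (hI.insert hne)
  have h1 : Submodule.span ℝ (A.col '' J) ≤ Submodule.span ℝ (A.col '' I) :=
    Submodule.span_le.2 hsub
  have key : ∀ K : Set (Fin m), LinearIndepOn ℝ A.col K →
      Module.finrank ℝ (Submodule.span ℝ (A.col '' K)) = K.ncard := by
    intro K hK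
    have h := finrank_span_eq_card (R := ℝ) hK.linearIndependent
    rw [Set.image_eq_range, h, Set.ncard_eq_toFinset_card', Set.toFinset_card]
  have h2 := Submodule.finrank_mono h1
  rw [key I hI, key J hJ] at h2
  omega

/-- The matroid `M_A` on the columns of `A`: a set of (indices of) columns is independent if these
columns are linearly independent. -/
def columnMatroid {n m : ℕ} (A : Matrix (Fin n) (Fin m) ℝ) : Matroid (Fin m) :=
  (IndepMatroid.ofFinite (E := Set.univ) Set.finite_univ (fun I => LinearIndepOn ℝ A.col I)
    (linearIndepOn_empty ℝ A.col) (fun _ _ hJ hIJ => hJ.mono hIJ) (columns_aug A)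
    (fun I _ => Set.subset_univ I)).matroid

/-- Two matroids are isomorphic if there is a bijection of their ground sets under which the
independent sets correspond. -/
def MatroidIso {α β : Type*} (M : Matroid α) (N : Matroid β) : Prop :=
  ∃ e : M.E ≃ N.E, ∀ I : Set M.E,
    M.Indep (Subtype.val '' I) ↔ N.Indep (Subtype.val '' (e '' I))

/-- A matroid is regular if it is (isomorphic to) the matroid of a totally unimodular matrix. -/
def IsRegularMatroid {α : Type*} (M : Matroid α) : Prop :=
  ∃ (n m : ℕ) (A : Matrix (Fin n) (Fin m) ℝ),
    A.IsTotallyUnimodular ∧ MatroidIso M (columnMatroid A)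

end Zonotopal

end

/-! The bridge between algebra and matrix is the Hamming weight on the row space. In the external
algebra the form `η · x` satisfies `(η · x) ^ (weight A η + 1) = 0` for every `η`, not only for
facet normals (`linForm_pow_mem_externalIdeal`). Sending each variable to a row of `A` maps the
algebra to `ℝ[y₁, …, y_m] / (y_j²)`, and there an element with linear part `θ` and no constant term
has a nonzero power of exponent `weight A θ` (`weight_lt_of_pow_mem`). An isomorphism, graded or
not, acts on linear parts and therefore preserves weights. A linear weight isometry of row spaces
comes from a permutation and rescaling of coordinates, as in MacWilliams' theorem
(`exists_equiv_eq_smul_of_card_eq`); this is z-equivalence. Conversely, z-equivalence gives a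
weight-preserving change of variables, hence a graded isomorphism, and also an isomorphism of
matroids.

Unimodularity enters in the passage from matroid to z-equivalence. By Cauchy–Binet, `det (A D_x Aᵀ)`
is the basis generating polynomial of the matroid. Its values at shifted weights determine the
principal minors of `1 + Π`, where `Π = Aᵀ (A D_x Aᵀ)⁻¹ A` has the row space as its range. Minors of
size at most three fix the squares and the triangle products of the entries of `Π`. For generic `x`
the nonvanishing of entries is an equivalence relation, so triangles suffice to conjugate one `Π` to
the other by signs (`exists_signs`).

For regularity, normalising a basis of columns to the unit matrix turns unimodular into totally
unimodular; conversely, keeping a row basis achieves full rank. -/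

open scoped Pointwise

noncomputable section

namespace Zonotopal

/-! ### Powers of linear forms in the external ideal. -/

section

open Polynomial in
/-- If `(y + c x) ^ (N - m c) = 0` for each `c` in a finite set, with total multiplicity
`∑ (m c + 1)` larger than `N`, then `x ^ N = 0`. -/
theorem pow_eq_zero_of_pow_add_smul_eq_zero {R : Type*} [CommRing R] [Algebra ℝ R] (x y : R)
    (N : ℕ) (S : Finset ℝ) (m : ℝ → ℕ) (hN : N < ∑ c ∈ S, (m c + 1))
    (h : ∀ c ∈ S, (y + c • x) ^ (N - m c) = 0) : x ^ N = 0 := by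
  classical
  rcases subsingleton_or_nontrivial R with hR | hR
  · exact Subsingleton.elim _ _
  -- The coefficient of degree `N` in `p` is `x ^ N`. Since `p` has degree at most `N` but is
  -- divisible by a monic polynomial of larger degree, it vanishes.
  let p : R[X] := (C y + X * C x) ^ N
  have hlin : ∀ c : ℝ, C y + X * C x =
      (X - C (algebraMap ℝ R c)) * C x + C (y + c • x) := by
    intro c
    rw [Algebra.smul_def]
    simp only [map_add, map_mul]
    ring
  have hdvd : ∀ c ∈ S, (X - C (algebraMap ℝ R c)) ^ (m c + 1) ∣ p := by
    intro c hc
    simp only [p]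
    rw [hlin c, add_pow]
    -- Expansion around `X = c`: the terms with `j ≤ m c` contain `(y + c x) ^ (N - j) = 0`.
    refine Finset.dvd_sum fun j hj => ?_
    by_cases hjm : m c + 1 ≤ j
    · rw [mul_pow]
      exact Dvd.dvd.mul_right (Dvd.dvd.mul_right (Dvd.dvd.mul_right (pow_dvd_pow _ hjm) _) _) _
    · have h0 : (y + c • x) ^ (N - j) = 0 :=
        pow_eq_zero_of_le (by omega) (h c hc)
      rw [← C_pow, h0]
      simp
  -- `R` need not be a domain, but differences of distinct real numbers are units in it.
  have hcop : Set.Pairwise (S : Set ℝ) (Function.onFun IsCoprime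
      fun c => (X - C (algebraMap ℝ R c)) ^ (m c + 1)) := by
    intro c _ d _ hcd
    refine IsCoprime.pow (isCoprime_X_sub_C_of_isUnit_sub ?_)
    rw [← map_sub]
    exact (isUnit_iff_ne_zero.2 (sub_ne_zero.2 hcd)).map (algebraMap ℝ R)
  have hprod : (∏ c ∈ S, (X - C (algebraMap ℝ R c)) ^ (m c + 1)) ∣ p :=
    Finset.prod_dvd_of_coprime hcop hdvd
  have hmon : ∀ c ∈ S, ((X - C (algebraMap ℝ R c)) ^ (m c + 1)).Monic :=
    fun c _ => (monic_X_sub_C _).pow _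
  have hdeg : (∏ c ∈ S, (X - C (algebraMap ℝ R c)) ^ (m c + 1)).natDegree
      = ∑ c ∈ S, (m c + 1) := by
    rw [natDegree_prod_of_monic _ _ hmon]
    refine Finset.sum_congr rfl fun c _ => ?_
    rw [(monic_X_sub_C _).natDegree_pow, natDegree_X_sub_C, mul_one]
  have hlin1 : (C y + X * C x).natDegree ≤ 1 := by
    rw [mul_comm]
    compute_degree
  have hp : p.natDegree ≤ N := by
    exact (natDegree_pow_le_of_le N hlin1).trans_eq (mul_one N)
  have hp0 : p = 0 := by
    by_contra hne
    exact (monic_prod_of_monic _ _ hmon).not_dvd_of_natDegree_lt hne (by omega) hprod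
  have hc : p.coeff (N * 1) = (C y + X * C x).coeff 1 ^ N := coeff_pow_of_natDegree_le hlin1
  rw [hp0] at hc
  simpa using hc.symm

variable {n m : ℕ}

theorem linForm_add (η θ : Fin n → ℝ) : linForm (η + θ) = linForm η + linForm θ := by
  simp [linForm, add_mul, Finset.sum_add_distrib]

theorem linForm_smul (c : ℝ) (η : Fin n → ℝ) : linForm (c • η) = c • linForm η := by
  simp [linForm, Finset.smul_sum, MvPolynomial.smul_eq_C_mul, mul_assoc]

theorem vecMul_apply (A : Matrix (Fin n) (Fin m) ℝ) (η : Fin n → ℝ) (j : Fin m) :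
    Matrix.vecMul η A j = η ⬝ᵥ A.col j := rfl

theorem span_col_eq_top {A : Matrix (Fin n) (Fin m) ℝ} (hA : A.rank = n) :
    Submodule.span ℝ (Set.range A.col) = ⊤ := by
  apply Submodule.eq_top_of_finrank_eq
  rw [← Matrix.rank_eq_finrank_span_cols, hA]
  simp

theorem vecMul_injective {A : Matrix (Fin n) (Fin m) ℝ} (hA : A.rank = n) :
    Function.Injective fun η => Matrix.vecMul η A := by
  rw [Matrix.vecMul_injective_iff]
  rw [linearIndependent_iff_card_eq_finrank_span, Set.finrank, ← Matrix.rank_eq_finrank_span_row, hA]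
  simp

theorem eq_zero_of_vecMul {A : Matrix (Fin n) (Fin m) ℝ} (hA : A.rank = n) {η : Fin n → ℝ}
    (h : ∀ j, Matrix.vecMul η A j = 0) : η = 0 :=
  vecMul_injective hA (by ext j; simp [h j])

theorem mem_zonotope {A : Matrix (Fin n) (Fin m) ℝ} {x : Fin n → ℝ} :
    x ∈ zonotope A ↔ ∃ t : Fin m → ℝ, (∀ j, t j ∈ Set.Icc (0 : ℝ) 1) ∧ x = ∑ j, t j • A.col j := by
  rw [zonotope, Set.mem_fintype_sum]
  constructor
  · rintro ⟨g, hg, rfl⟩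
    choose t ht using fun j => (segment_eq_image ℝ (0 : Fin n → ℝ) (A.col j) ▸ hg j)
    exact ⟨t, fun j => (ht j).1, Finset.sum_congr rfl fun j _ => by simpa using (ht j).2.symm⟩
  · rintro ⟨t, ht, rfl⟩
    refine ⟨fun j => t j • A.col j, fun j => ?_, rfl⟩
    rw [segment_eq_image]
    exact ⟨t j, ht j, by simp⟩

/-- The face of the zonotope in direction `η`. -/
def maxFace (A : Matrix (Fin n) (Fin m) ℝ) (η : Fin n → ℝ) : Set (Fin n → ℝ) :=
  {x ∈ zonotope A | ∀ y ∈ zonotope A, η ⬝ᵥ y ≤ η ⬝ᵥ x}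

theorem dotProduct_sum_col (A : Matrix (Fin n) (Fin m) ℝ) (η : Fin n → ℝ) (t : Fin m → ℝ) :
    η ⬝ᵥ (∑ j, t j • A.col j) = ∑ j, t j * (η ⬝ᵥ A.col j) := by
  rw [dotProduct_sum]
  simp

theorem sum_col_mem_maxFace (A : Matrix (Fin n) (Fin m) ℝ) (η : Fin n → ℝ) (t : Fin m → ℝ)
    (ht : ∀ j, t j ∈ Set.Icc (0 : ℝ) 1) (hpos : ∀ j, 0 < η ⬝ᵥ A.col j → t j = 1)
    (hneg : ∀ j, η ⬝ᵥ A.col j < 0 → t j = 0) : ∑ j, t j • A.col j ∈ maxFace A η := by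
  refine ⟨mem_zonotope.2 ⟨t, ht, rfl⟩, fun y hy => ?_⟩
  obtain ⟨s, hs, rfl⟩ := mem_zonotope.1 hy
  rw [dotProduct_sum_col, dotProduct_sum_col]
  refine Finset.sum_le_sum fun j _ => ?_
  rcases lt_trichotomy (η ⬝ᵥ A.col j) 0 with h | h | h
  · rw [hneg j h]; nlinarith [(hs j).1]
  · rw [h]; simp
  · rw [hpos j h]; nlinarith [(hs j).2]

theorem maxFace_isExposed (A : Matrix (Fin n) (Fin m) ℝ) (η : Fin n → ℝ) :
    IsExposed ℝ (zonotope A) (maxFace A η) := by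
  intro _
  refine ⟨LinearMap.toContinuousLinearMap (dotProductBilin ℝ ℝ η), ?_⟩
  ext x
  simp [maxFace]

/-- The coefficient of a column orthogonal to `η` is free on the face, and moving it from 0 to 1
translates by that column. -/
theorem col_mem_vectorSpan_maxFace (A : Matrix (Fin n) (Fin m) ℝ) (η : Fin n → ℝ) (j : Fin m)
    (hj : η ⬝ᵥ A.col j = 0) : A.col j ∈ vectorSpan ℝ (maxFace A η) := by
  classical
  let t : Fin m → ℝ := fun i => if 0 < η ⬝ᵥ A.col i then 1 else 0
  have h0 : ∑ i, t i • A.col i ∈ maxFace A η := by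
    refine sum_col_mem_maxFace A η t (fun i => ?_) (fun i hi => by simp [t, hi])
      (fun i hi => by simp [t, hi.le])
    simp only [t]; split_ifs <;> simp
  have h1 : ∑ i, Function.update t j 1 i • A.col i ∈ maxFace A η := by
    refine sum_col_mem_maxFace A η _ (fun i => ?_) (fun i hi => ?_) (fun i hi => ?_)
    · rcases eq_or_ne i j with rfl | hij
      · simp
      · rw [Function.update_of_ne hij]; simp only [t]; split_ifs <;> simp
    · have hij : i ≠ j := by rintro rfl; linarith
      rw [Function.update_of_ne hij]; simp [t, hi]
    · have hij : i ≠ j := by rintro rfl; linarith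
      rw [Function.update_of_ne hij]; simp [t, hi.le]
  have hsub := vsub_mem_vectorSpan ℝ h1 h0
  have heq : (∑ i, Function.update t j 1 i • A.col i) -ᵥ (∑ i, t i • A.col i) = A.col j := by
    rw [vsub_eq_sub, ← Finset.sum_sub_distrib, Finset.sum_eq_single j]
    · simp [t, hj]
    · intro i _ hij
      simp [Function.update_of_ne hij]
    · simp
  rwa [heq] at hsub

theorem vectorSpan_zonotope {A : Matrix (Fin n) (Fin m) ℝ} (hA : A.rank = n) :
    vectorSpan ℝ (zonotope A) = ⊤ := by
  classical
  rw [eq_top_iff, ← span_col_eq_top hA, Submodule.span_le]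
  rintro _ ⟨j, rfl⟩
  have h0 : (0 : Fin n → ℝ) ∈ zonotope A := mem_zonotope.2 ⟨0, by simp, by simp⟩
  have h1 : A.col j ∈ zonotope A := by
    refine mem_zonotope.2 ⟨Pi.single j 1, fun i => ?_, ?_⟩
    · rcases eq_or_ne i j with rfl | hij
      · simp
      · simp [hij]
    · rw [Finset.sum_eq_single j] <;> simp +contextual
  simpa using vsub_mem_vectorSpan ℝ h1 h0

theorem finrank_ker_dotProduct {η : Fin n → ℝ} (hη : η ≠ 0) :
    Module.finrank ℝ (LinearMap.ker (dotProductBilin ℝ ℝ η : (Fin n → ℝ) →ₗ[ℝ] ℝ)) + 1 = n := by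
  have h := Module.Dual.finrank_ker_add_one_of_ne_zero
    (f := (dotProductBilin ℝ ℝ η : (Fin n → ℝ) →ₗ[ℝ] ℝ)) (by
      intro h
      apply hη
      have := LinearMap.congr_fun h η
      simpa using this)
  simpa using h

theorem maxFace_isNormal (A : Matrix (Fin n) (Fin m) ℝ) {η : Fin n → ℝ} (hη : η ≠ 0) :
    IsNormal (maxFace A η) η :=
  ⟨hη, fun x hx y hy => le_antisymm (hy.2 x hx.1) (hx.2 y hy.1)⟩

theorem maxFace_isFacet {A : Matrix (Fin n) (Fin m) ℝ} (hA : A.rank = n) {η : Fin n → ℝ}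
    (hη : η ≠ 0)
    (h : LinearMap.ker (dotProductBilin ℝ ℝ η : (Fin n → ℝ) →ₗ[ℝ] ℝ) ≤
      Submodule.span ℝ (A.col '' {j | η ⬝ᵥ A.col j = 0})) :
    IsFacet (zonotope A) (maxFace A η) := by
  classical
  refine ⟨⟨_, sum_col_mem_maxFace A η (fun i => if 0 < η ⬝ᵥ A.col i then 1 else 0) (fun i => ?_)
      (fun i hi => by simp [hi]) (fun i hi => by simp [hi.le])⟩, maxFace_isExposed A η, ?_⟩
  · split_ifs <;> simp
  · have hle : LinearMap.ker (dotProductBilin ℝ ℝ η : (Fin n → ℝ) →ₗ[ℝ] ℝ) ≤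
        vectorSpan ℝ (maxFace A η) := by
      refine h.trans (Submodule.span_le.2 ?_)
      rintro _ ⟨j, hj, rfl⟩
      exact col_mem_vectorSpan_maxFace A η j hj
    have hge : vectorSpan ℝ (maxFace A η) ≤
        LinearMap.ker (dotProductBilin ℝ ℝ η : (Fin n → ℝ) →ₗ[ℝ] ℝ) := by
      rw [vectorSpan_def, Submodule.span_le]
      rintro _ ⟨x, hx, y, hy, rfl⟩
      have := (maxFace_isNormal A hη).2 x hx y hy
      simp [dotProduct_sub, this]
    rw [le_antisymm hge hle, finrank_ker_dotProduct hη, vectorSpan_zonotope hA]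
    simp

theorem weight_eq_card (A : Matrix (Fin n) (Fin m) ℝ) (η : Fin n → ℝ) :
    weight A η = (Finset.univ.filter fun j => Matrix.vecMul η A j ≠ 0).card := by
  classical
  rw [weight, Set.ncard_eq_toFinset_card', Set.toFinset_ofPred]

/-- The powers of all linear forms, not only of facet normals, belong to the external ideal. -/
theorem linForm_pow_mem_externalIdeal {A : Matrix (Fin n) (Fin m) ℝ} (hA : A.rank = n)
    (η : Fin n → ℝ) : linForm η ^ (weight A η + 1) ∈ externalIdeal A := by
  classical
  induction hw : weight A η using Nat.strong_induction_on generalizing η with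
  | _ w ih =>
  rcases eq_or_ne η 0 with rfl | hη
  · simp [linForm]
  -- If the columns killed by `η` determine it up to a factor, they span its orthogonal hyperplane
  -- and `η` is a facet normal. Otherwise the pencil `θ + c η` reduces the claim to smaller weights.
  by_cases hcase : ∀ θ : Fin n → ℝ, (∀ j, η ⬝ᵥ A.col j = 0 → θ ⬝ᵥ A.col j = 0) →
      ∃ c : ℝ, θ = c • η
  · refine Ideal.subset_span ⟨maxFace A η, η, maxFace_isFacet hA hη fun x hx => ?_,
      maxFace_isNormal A hη, by rw [hw]⟩
    by_contra hx'
    obtain ⟨f, hfx, hf⟩ := Submodule.exists_le_ker_of_notMem hx'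
    obtain ⟨θ, rfl⟩ := (dotProductEquiv ℝ (Fin n)).surjective f
    obtain ⟨c, rfl⟩ := hcase θ fun j hj => by
      simpa using hf (Submodule.subset_span ⟨j, hj, rfl⟩)
    apply hfx
    have : η ⬝ᵥ x = 0 := by simpa using hx
    simp [this]
  · push Not at hcase
    obtain ⟨θ, hθ, hne⟩ := hcase
    let T : Finset (Fin m) := Finset.univ.filter fun j => Matrix.vecMul η A j ≠ 0
    have hTmem : ∀ j, j ∈ T ↔ η ⬝ᵥ A.col j ≠ 0 := fun j => by
      simp only [T, Finset.mem_filter, Finset.mem_univ, true_and]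
      rfl
    have hT : T.card = w := by rw [← hw, weight_eq_card]
    -- The value of `c` at which coordinate `j` of `(θ + c η) A` vanishes; `μ c` counts the
    -- coordinates lost at `c`.
    let r : Fin m → ℝ := fun j => -(θ ⬝ᵥ A.col j) / (η ⬝ᵥ A.col j)
    let S : Finset ℝ := T.image r
    let μ : ℝ → ℕ := fun c => (T.filter fun j => r j = c).card
    have hsum : ∑ c ∈ S, μ c = w := by
      rw [← hT]
      exact (Finset.card_eq_sum_card_image r T).symm
    have hweight : ∀ c, weight A (θ + c • η) + μ c = w := by
      intro c
      rw [weight_eq_card, ← hT, ← Finset.card_filter_add_card_filter_not (s := T)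
        (fun j => r j = c), add_comm]
      congr 2
      ext j
      have hj' : Matrix.vecMul (θ + c • η) A j = θ ⬝ᵥ A.col j + c * η ⬝ᵥ A.col j := by
        rw [vecMul_apply, add_dotProduct, smul_dotProduct, smul_eq_mul]
      simp only [Finset.mem_filter, Finset.mem_univ, true_and, hTmem, hj', r]
      by_cases hj : η ⬝ᵥ A.col j = 0
      · simp [hj, hθ j hj]
      · simp only [hj, ne_eq, not_false_eq_true, true_and]
        rw [div_eq_iff hj, not_iff_not]
        constructor <;> intro h <;> linarith
    -- With a single root, `θ` would be a multiple of `η`. Two roots give `∑ (μ c + 1) ≥ w + 2`,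
    -- just above the exponent `w + 1`.
    have hS : 2 ≤ S.card := by
      by_contra hlt
      have hle : S.card ≤ 1 := by omega
      rw [Finset.card_le_one] at hle
      obtain ⟨c, hc⟩ : ∃ c, ∀ j ∈ T, r j = c := by
        rcases T.eq_empty_or_nonempty with hE | ⟨j, hj⟩
        · exact ⟨0, by simp [hE]⟩
        · exact ⟨r j, fun i hi => hle _ (Finset.mem_image_of_mem r hi) _
            (Finset.mem_image_of_mem r hj)⟩
      apply hne (-c)
      rw [neg_smul, eq_neg_iff_add_eq_zero]
      refine eq_zero_of_vecMul hA fun j => ?_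
      rw [vecMul_apply, add_dotProduct, smul_dotProduct, smul_eq_mul]
      by_cases hj : η ⬝ᵥ A.col j = 0
      · simp [hj, hθ j hj]
      · have := hc j ((hTmem j).2 hj)
        simp only [r] at this
        rw [div_eq_iff hj] at this
        linarith
    have hpow := pow_eq_zero_of_pow_add_smul_eq_zero
      (Ideal.Quotient.mk (externalIdeal A) (linForm η))
      (Ideal.Quotient.mk (externalIdeal A) (linForm θ)) (w + 1) S μ (by
        rw [Finset.sum_add_distrib, hsum]; simp; omega) (by
        intro c hc
        have hμ : 0 < μ c := by
          obtain ⟨j, hj, hjc⟩ := Finset.mem_image.1 hc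
          exact Finset.card_pos.2 ⟨j, by simp [hj, hjc]⟩
        have hw' := hweight c
        have hmem := ih (weight A (θ + c • η)) (by omega) (θ + c • η) rfl
        rw [show w + 1 - μ c = weight A (θ + c • η) + 1 by omega]
        rw [← Ideal.Quotient.mkₐ_eq_mk ℝ, ← map_smul, ← map_add, ← linForm_smul, ← linForm_add,
          ← map_pow, Ideal.Quotient.mkₐ_eq_mk]
        exact Ideal.Quotient.eq_zero_iff_mem.2 hmem)
    rw [← map_pow] at hpow
    exact Ideal.Quotient.eq_zero_iff_mem.1 hpow

/-- Facets disappear from the description: the ideal depends on the weight function alone, so a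
weight-preserving substitution transports it. -/
theorem externalIdeal_eq_span {A : Matrix (Fin n) (Fin m) ℝ} (hA : A.rank = n) :
    externalIdeal A = Ideal.span (Set.range fun η => linForm η ^ (weight A η + 1)) := by
  apply le_antisymm
  · refine Ideal.span_mono ?_
    rintro _ ⟨F, η, _, _, rfl⟩
    exact ⟨η, rfl⟩
  · rw [Ideal.span_le]
    rintro _ ⟨η, rfl⟩
    exact linForm_pow_mem_externalIdeal hA η

end

/-! ### Linear substitutions and linear parts. -/

section

variable {n₁ m₁ n₂ m₂ : ℕ}

/-- There is a linear isomorphism between the spaces of linear forms that preserves the number of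
nonzero coordinates of the corresponding vectors of the row spaces. -/
def WeightIso (A₁ : Matrix (Fin n₁) (Fin m₁) ℝ) (A₂ : Matrix (Fin n₂) (Fin m₂) ℝ) : Prop :=
  ∃ ψ : (Fin n₁ → ℝ) ≃ₗ[ℝ] (Fin n₂ → ℝ), ∀ η, weight A₂ (ψ η) = weight A₁ η

/-- The linear substitution `x_i ↦ ψ e_i` of variables. -/
def linSubst (ψ : (Fin n₁ → ℝ) →ₗ[ℝ] (Fin n₂ → ℝ)) :
    MvPolynomial (Fin n₁) ℝ →ₐ[ℝ] MvPolynomial (Fin n₂) ℝ :=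
  MvPolynomial.aeval fun i => linForm (ψ (Pi.single i 1))

/-- `linForm` as a linear map. -/
def linFormₗ (n : ℕ) : (Fin n → ℝ) →ₗ[ℝ] MvPolynomial (Fin n) ℝ where
  toFun := linForm
  map_add' := linForm_add
  map_smul' := linForm_smul

theorem linForm_single {n : ℕ} (i : Fin n) : linForm (Pi.single i 1) = MvPolynomial.X i := by
  rw [linForm, Finset.sum_eq_single i] <;> simp +contextual

theorem linForm_isHomogeneous {n : ℕ} (η : Fin n → ℝ) : (linForm η).IsHomogeneous 1 :=
  MvPolynomial.IsHomogeneous.sum _ _ _ fun i _ => by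
    simpa using (MvPolynomial.isHomogeneous_C _ (η i)).mul (MvPolynomial.isHomogeneous_X ℝ i)

theorem linSubst_linForm (ψ : (Fin n₁ → ℝ) →ₗ[ℝ] (Fin n₂ → ℝ)) (η : Fin n₁ → ℝ) :
    linSubst ψ (linForm η) = linForm (ψ η) := by
  have : (linSubst ψ).toLinearMap ∘ₗ linFormₗ n₁ = linFormₗ n₂ ∘ₗ ψ := by
    refine LinearMap.pi_ext' fun i => LinearMap.ext_ring ?_
    simp [linFormₗ, linForm_single, linSubst]
  exact LinearMap.congr_fun this η

theorem linSubst_comp_symm (ψ : (Fin n₁ → ℝ) ≃ₗ[ℝ] (Fin n₂ → ℝ)) :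
    (linSubst ψ.toLinearMap).comp (linSubst ψ.symm.toLinearMap) = AlgHom.id ℝ _ := by
  refine MvPolynomial.algHom_ext fun i => ?_
  rw [← linForm_single, AlgHom.comp_apply, linSubst_linForm, linSubst_linForm]
  simp

/-- The linear substitution of variables as an isomorphism. -/
def linSubstEquiv (ψ : (Fin n₁ → ℝ) ≃ₗ[ℝ] (Fin n₂ → ℝ)) :
    MvPolynomial (Fin n₁) ℝ ≃ₐ[ℝ] MvPolynomial (Fin n₂) ℝ :=
  AlgEquiv.ofAlgHom (linSubst ψ.toLinearMap) (linSubst ψ.symm.toLinearMap)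
    (linSubst_comp_symm ψ) (by simpa using linSubst_comp_symm ψ.symm)

theorem linSubst_isHomogeneous (ψ : (Fin n₁ → ℝ) →ₗ[ℝ] (Fin n₂ → ℝ)) {d : ℕ}
    {p : MvPolynomial (Fin n₁) ℝ} (hp : p.IsHomogeneous d) : (linSubst ψ p).IsHomogeneous d := by
  simpa [linSubst] using hp.aeval (fun i => linForm (ψ (Pi.single i 1)))
    (fun i => linForm_isHomogeneous _)

theorem map_externalIdeal {A₁ : Matrix (Fin n₁) (Fin m₁) ℝ} {A₂ : Matrix (Fin n₂) (Fin m₂) ℝ}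
    (h₁ : A₁.rank = n₁) (h₂ : A₂.rank = n₂) (ψ : (Fin n₁ → ℝ) ≃ₗ[ℝ] (Fin n₂ → ℝ))
    (hψ : ∀ η, weight A₂ (ψ η) = weight A₁ η) :
    externalIdeal A₂ = (externalIdeal A₁).map (linSubstEquiv ψ : _ →+* _) := by
  rw [externalIdeal_eq_span h₁, externalIdeal_eq_span h₂, Ideal.map_span, ← Set.range_comp]
  congr 1
  rw [← ψ.surjective.range_comp]
  congr 1
  ext1 η
  simp [linSubstEquiv, linSubst_linForm, hψ]

theorem WeightIso.gradedAlgebraIso {A₁ : Matrix (Fin n₁) (Fin m₁) ℝ}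
    {A₂ : Matrix (Fin n₂) (Fin m₂) ℝ} (h₁ : A₁.rank = n₁) (h₂ : A₂.rank = n₂)
    (h : WeightIso A₁ A₂) : GradedAlgebraIso A₁ A₂ := by
  obtain ⟨ψ, hψ⟩ := h
  refine ⟨Ideal.quotientEquivAlg _ _ (linSubstEquiv ψ) (map_externalIdeal h₁ h₂ ψ hψ), fun d => ?_⟩
  apply le_antisymm
  · rintro _ ⟨_, ⟨p, hp, rfl⟩, rfl⟩
    exact ⟨linSubst ψ.toLinearMap p, linSubst_isHomogeneous _ hp, rfl⟩
  · rintro _ ⟨p, hp, rfl⟩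
    refine ⟨_, ⟨linSubst ψ.symm.toLinearMap p, linSubst_isHomogeneous _ hp, rfl⟩, ?_⟩
    have : linSubst ψ.toLinearMap (linSubst ψ.symm.toLinearMap p) = p :=
      AlgHom.congr_fun (linSubst_comp_symm ψ) p
    conv_rhs => rw [← this]
    rfl

theorem GradedAlgebraIso.algebraIso {A₁ : Matrix (Fin n₁) (Fin m₁) ℝ}
    {A₂ : Matrix (Fin n₂) (Fin m₂) ℝ} (h : GradedAlgebraIso A₁ A₂) : AlgebraIso A₁ A₂ :=
  let ⟨e, _⟩ := h
  ⟨e⟩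

section LinearPart

variable {n m : ℕ}

/-- The constant and linear part of a polynomial, as an algebra homomorphism. -/
def linearPart (n : ℕ) : MvPolynomial (Fin n) ℝ →ₐ[ℝ] TrivSqZeroExt ℝ (Fin n → ℝ) :=
  MvPolynomial.aeval fun i => TrivSqZeroExt.inr (Pi.single i 1)

theorem linearPart_linForm (η : Fin n → ℝ) : linearPart n (linForm η) = TrivSqZeroExt.inr η := by
  have : (linearPart n).toLinearMap ∘ₗ linFormₗ n = TrivSqZeroExt.inrHom ℝ (Fin n → ℝ) := by
    refine LinearMap.pi_ext' fun i => LinearMap.ext_ring ?_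
    simp [linFormₗ, linForm_single, linearPart]
  exact LinearMap.congr_fun this η

theorem sub_linearPart_mem (p : MvPolynomial (Fin n) ℝ) :
    p - MvPolynomial.C (linearPart n p).fst - linForm (linearPart n p).snd ∈
      MvPolynomial.idealOfVars (Fin n) ℝ ^ 2 := by
  have hX : ∀ i, MvPolynomial.X i ∈ MvPolynomial.idealOfVars (Fin n) ℝ :=
    fun i => Ideal.subset_span ⟨i, rfl⟩
  have hlin : ∀ η, linForm η ∈ MvPolynomial.idealOfVars (Fin n) ℝ := fun η =>
    Ideal.sum_mem _ fun i _ => Ideal.mul_mem_left _ _ (hX i)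
  induction p using MvPolynomial.induction_on with
  | C a =>
    simp [linearPart, TrivSqZeroExt.algebraMap_eq_inl, linForm]
  | add p q hp hq =>
    convert Ideal.add_mem _ hp hq using 1
    rw [map_add, TrivSqZeroExt.fst_add, TrivSqZeroExt.snd_add, linForm_add, map_add]
    ring
  | mul_X p i hp =>
    have h1 : linearPart n (p * MvPolynomial.X i) =
        TrivSqZeroExt.inr ((linearPart n p).fst • Pi.single i 1) := by
      rw [map_mul]
      nth_rw 2 [linearPart]
      rw [MvPolynomial.aeval_X]
      ext <;> simp
    rw [h1, TrivSqZeroExt.fst_inr, TrivSqZeroExt.snd_inr, linForm_smul, linForm_single,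
      MvPolynomial.smul_eq_C_mul, map_zero, sub_zero, ← sub_mul, pow_two]
    refine Ideal.mul_mem_mul ?_ (hX i)
    have h2 := Ideal.add_mem _ (Ideal.pow_le_self two_ne_zero hp) (hlin (linearPart n p).snd)
    simpa using h2

theorem weight_pos {A : Matrix (Fin n) (Fin m) ℝ} (hA : A.rank = n) {η : Fin n → ℝ} (hη : η ≠ 0) :
    0 < weight A η := by
  rw [weight_eq_card, Finset.card_pos]
  by_contra h
  rw [Finset.not_nonempty_iff_eq_empty, Finset.filter_eq_empty_iff] at h
  exact hη (eq_zero_of_vecMul hA fun j => by simpa using h (Finset.mem_univ j))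

/-- The constant and linear part of an element of the external algebra. -/
def quotLinearPart {A : Matrix (Fin n) (Fin m) ℝ} (hA : A.rank = n) :
    ExternalAlgebra A →ₐ[ℝ] TrivSqZeroExt ℝ (Fin n → ℝ) :=
  Ideal.Quotient.liftₐ _ (linearPart n) fun p hp => by
    have hle : externalIdeal A ≤ RingHom.ker (linearPart n) := by
      refine Ideal.span_le.2 ?_
      rintro _ ⟨F, η, _, hη, rfl⟩
      -- A facet normal is nonzero, so its weight is positive and the generator has exponent at
      -- least 2.
      obtain ⟨k, hk⟩ := Nat.exists_eq_add_of_lt (weight_pos hA hη.1)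
      rw [SetLike.mem_coe, RingHom.mem_ker, map_pow, linearPart_linForm, hk,
        show 0 + k + 1 + 1 = 2 + k by ring, pow_add, pow_two, TrivSqZeroExt.inr_mul_inr, zero_mul]
    exact hle hp

theorem quotLinearPart_mk {A : Matrix (Fin n) (Fin m) ℝ} (hA : A.rank = n)
    (p : MvPolynomial (Fin n) ℝ) :
    quotLinearPart hA (Ideal.Quotient.mk (externalIdeal A) p) = linearPart n p := rfl

/-- The map of the polynomial ring into the polynomial ring in the columns that sends `x_i` to
the linear form with the coefficients of the `i`-th row. -/
def rowSubst (A : Matrix (Fin n) (Fin m) ℝ) :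
    MvPolynomial (Fin n) ℝ →ₐ[ℝ] MvPolynomial (Fin m) ℝ :=
  linSubst (Matrix.vecMulLinear A)

theorem rowSubst_linForm (A : Matrix (Fin n) (Fin m) ℝ) (η : Fin n → ℝ) :
    rowSubst A (linForm η) = linForm (Matrix.vecMul η A) := by
  rw [rowSubst, linSubst_linForm]
  rfl

end LinearPart

end

/-! ### Nilpotency indices and algebra isomorphisms. -/

section

variable {n m n₁ m₁ n₂ m₂ : ℕ}

theorem add_pow_of_sq_eq_zero {R : Type*} [CommRing R] {a : R} (b : R) (ha : a * a = 0) (k : ℕ) :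
    (a + b) ^ (k + 1) = b ^ (k + 1) + (k + 1) * (a * b ^ k) := by
  induction k with
  | zero => simp [add_comm]
  | succ k ih =>
    rw [pow_succ, ih]
    push_cast
    linear_combination (k + 1 : R) * b ^ k * ha

/-- Only squarefree products survive in a power of the sum: the full product arises from `|S|!`
orderings, and nothing is left one degree higher. -/
theorem sum_pow_of_sq_eq_zero {R ι : Type*} [CommRing R] (a : ι → R) (ha : ∀ i, a i * a i = 0)
    (S : Finset ι) : (∑ i ∈ S, a i) ^ S.card = S.card.factorial * ∏ i ∈ S, a i ∧
      (∑ i ∈ S, a i) ^ (S.card + 1) = 0 := by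
  classical
  induction S using Finset.induction_on with
  | empty => simp
  | insert i S hi ih =>
    rw [Finset.sum_insert hi, Finset.prod_insert hi, Finset.card_insert_of_notMem hi,
      add_pow_of_sq_eq_zero _ (ha i), add_pow_of_sq_eq_zero _ (ha i), pow_succ _ (S.card + 1),
      ih.1, ih.2, Nat.factorial_succ]
    push_cast
    constructor <;> ring

/-- The ideal generated by the squares of the variables. -/
def squaresIdeal (m : ℕ) : Ideal (MvPolynomial (Fin m) ℝ) :=
  Ideal.span ((fun s => MvPolynomial.monomial s (1 : ℝ)) '' Set.range fun j => Finsupp.single j 2)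

theorem mk_squaresIdeal_linForm (v : Fin m → ℝ) :
    Ideal.Quotient.mk (squaresIdeal m) (linForm v) = ∑ j ∈ Finset.univ.filter fun j => v j ≠ 0,
      Ideal.Quotient.mk (squaresIdeal m) (MvPolynomial.C (v j) * MvPolynomial.X j) := by
  rw [linForm, map_sum, Finset.sum_filter_of_ne]
  intro j _ hj h0
  simp [h0] at hj

theorem mk_squaresIdeal_sq (v : Fin m → ℝ) (j : Fin m) :
    Ideal.Quotient.mk (squaresIdeal m) (MvPolynomial.C (v j) * MvPolynomial.X j) *
      Ideal.Quotient.mk (squaresIdeal m) (MvPolynomial.C (v j) * MvPolynomial.X j) = 0 := by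
  rw [← map_mul, Ideal.Quotient.eq_zero_iff_mem]
  have h : MvPolynomial.X j ^ 2 ∈ squaresIdeal m :=
    Ideal.subset_span ⟨_, ⟨j, rfl⟩, by rw [MvPolynomial.X_pow_eq_monomial]⟩
  convert Ideal.mul_mem_left _ (MvPolynomial.C (v j) * MvPolynomial.C (v j)) h using 1
  ring

theorem rowSubst_mem_squaresIdeal (A : Matrix (Fin n) (Fin m) ℝ) {p : MvPolynomial (Fin n) ℝ}
    (hp : p ∈ externalIdeal A) : rowSubst A p ∈ squaresIdeal m := by
  have hle : externalIdeal A ≤ (squaresIdeal m).comap (rowSubst A) := by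
    refine Ideal.span_le.2 ?_
    rintro _ ⟨F, η, _, _, rfl⟩
    rw [SetLike.mem_coe, Ideal.mem_comap, map_pow, rowSubst_linForm,
      ← Ideal.Quotient.eq_zero_iff_mem, map_pow, mk_squaresIdeal_linForm, weight_eq_card]
    exact (sum_pow_of_sq_eq_zero _ (mk_squaresIdeal_sq _) _).2
  exact hle hp

theorem prod_C_mul_X (v : Fin m → ℝ) (S : Finset (Fin m)) :
    ∏ j ∈ S, (MvPolynomial.C (v j) * MvPolynomial.X j) =
      MvPolynomial.monomial (∑ j ∈ S, Finsupp.single j 1) (∏ j ∈ S, v j) := by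
  classical
  induction S using Finset.induction_on with
  | empty => simp
  | insert i S hi ih =>
    rw [Finset.prod_insert hi, Finset.prod_insert hi, Finset.sum_insert hi, ih,
      MvPolynomial.C_mul_X_eq_monomial, MvPolynomial.monomial_mul]

/-- Modulo squares the power is a nonzero multiple of the squarefree monomial on the support of `v`,
whose coefficient vanishes on both ideals. The second ideal absorbs the higher-order terms of a
nonlinear element. -/
theorem linForm_pow_notMem (v : Fin m → ℝ) :
    linForm v ^ (Finset.univ.filter fun j => v j ≠ 0).card ∉ squaresIdeal m ⊔
      MvPolynomial.idealOfVars (Fin m) ℝ ^ ((Finset.univ.filter fun j => v j ≠ 0).card + 1) := by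
  classical
  set S := Finset.univ.filter fun j => v j ≠ 0
  intro hmem
  have h1 : linForm v ^ S.card - (S.card.factorial : MvPolynomial (Fin m) ℝ) *
      MvPolynomial.monomial (∑ j ∈ S, Finsupp.single j 1) (∏ j ∈ S, v j) ∈ squaresIdeal m := by
    rw [← Ideal.Quotient.eq, map_pow, mk_squaresIdeal_linForm, map_mul, ← prod_C_mul_X, map_prod,
      map_natCast]
    exact (sum_pow_of_sq_eq_zero _ (mk_squaresIdeal_sq _) _).1
  have h2 := Ideal.sub_mem _ hmem (Ideal.mem_sup_left h1)
  rw [sub_sub_cancel] at h2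
  obtain ⟨a, ha, b, hb, hab⟩ := Submodule.mem_sup.1 h2
  have hca : a.coeff (∑ j ∈ S, Finsupp.single j 1) = 0 := by
    by_contra hne
    obtain ⟨_, ⟨j, rfl⟩, hj⟩ := MvPolynomial.mem_ideal_span_monomial_image.1 ha _
      (MvPolynomial.mem_support_iff.2 hne)
    have := hj j
    rw [Finsupp.finsetSum_apply] at this
    simp only [Finsupp.single_eq_same, Finsupp.single_apply] at this
    rw [Finset.sum_ite_eq'] at this
    split_ifs at this <;> omega
  have hcb : b.coeff (∑ j ∈ S, Finsupp.single j 1) = 0 := by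
    refine (MvPolynomial.mem_pow_idealOfVars_iff' _ _).1 hb _ ?_
    simp [map_sum]
  have hc := congrArg (MvPolynomial.coeff (∑ j ∈ S, Finsupp.single j 1)) hab
  rw [MvPolynomial.coeff_add, hca, hcb, add_zero, ← map_natCast MvPolynomial.C,
    MvPolynomial.coeff_C_mul, MvPolynomial.coeff_monomial, if_pos rfl] at hc
  have hS : ∏ j ∈ S, v j ≠ 0 := Finset.prod_ne_zero_iff.2 fun j hj => (Finset.mem_filter.1 hj).2
  exact mul_ne_zero (by exact_mod_cast S.card.factorial_ne_zero) hS hc.symm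

theorem pow_sub_pow_mem {R : Type*} [CommRing R] {M : Ideal R} {x y : R} (hx : x ∈ M) (hy : y ∈ M)
    (hxy : x - y ∈ M ^ 2) (k : ℕ) : x ^ k - y ^ k ∈ M ^ (k + 1) := by
  induction k with
  | zero => simp
  | succ k ih =>
    have h1 : x ^ k * (x - y) ∈ M ^ (k + 1 + 1) := by
      rw [add_assoc, pow_add]
      exact Ideal.mul_mem_mul (Ideal.pow_mem_pow hx k) hxy
    have h2 : (x ^ k - y ^ k) * y ∈ M ^ (k + 1 + 1) := by
      rw [pow_succ]
      exact Ideal.mul_mem_mul ih hy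
    convert Ideal.add_mem _ h1 h2 using 1
    ring

/-- A polynomial with linear part `θ` and no constant part has nilpotency index larger than
`weight A θ` in the external algebra. -/
theorem weight_lt_of_pow_mem {A : Matrix (Fin n) (Fin m) ℝ} {p : MvPolynomial (Fin n) ℝ}
    {θ : Fin n → ℝ} (hp : linearPart n p = TrivSqZeroExt.inr θ) {k : ℕ}
    (hk : p ^ k ∈ externalIdeal A) : weight A θ < k := by
  by_contra hlt
  have hkw := Ideal.mem_of_dvd _ (pow_dvd_pow p (not_lt.1 hlt)) hk
  have hsub := sub_linearPart_mem p
  rw [hp, TrivSqZeroExt.fst_inr, TrivSqZeroExt.snd_inr, map_zero, sub_zero] at hsub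
  have hmap : (MvPolynomial.idealOfVars (Fin n) ℝ).map (rowSubst A) ≤
      MvPolynomial.idealOfVars (Fin m) ℝ := by
    rw [MvPolynomial.idealOfVars, Ideal.map_span, Ideal.span_le]
    rintro _ ⟨_, ⟨i, rfl⟩, rfl⟩
    rw [← linForm_single, rowSubst_linForm]
    exact Ideal.sum_mem _ fun i _ => Ideal.mul_mem_left _ _ (Ideal.subset_span ⟨i, rfl⟩)
  have hlin : ∀ v : Fin m → ℝ, linForm v ∈ MvPolynomial.idealOfVars (Fin m) ℝ := fun η =>
    Ideal.sum_mem _ fun i _ => Ideal.mul_mem_left _ _ (Ideal.subset_span ⟨i, rfl⟩)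
  have h2 : rowSubst A p - linForm (Matrix.vecMul θ A) ∈
      MvPolynomial.idealOfVars (Fin m) ℝ ^ 2 := by
    rw [← rowSubst_linForm, ← map_sub]
    refine Ideal.pow_right_mono hmap 2 ?_
    rw [← Ideal.map_pow]
    exact Ideal.mem_map_of_mem _ hsub
  have h1 : rowSubst A p ∈ MvPolynomial.idealOfVars (Fin m) ℝ := by
    simpa using Ideal.add_mem _ (Ideal.pow_le_self two_ne_zero h2) (hlin (Matrix.vecMul θ A))
  -- Terms of order two in `p` affect its power of exponent `weight A θ` only in degree above
  -- `weight A θ`.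
  have h3 := pow_sub_pow_mem h1 (hlin _) h2 (weight A θ)
  have h4 := rowSubst_mem_squaresIdeal A hkw
  rw [map_pow] at h4
  have h5 := Ideal.sub_mem _ (Ideal.mem_sup_left h4) (Ideal.mem_sup_right h3)
  rw [sub_sub_cancel, weight_eq_card] at h5
  exact linForm_pow_notMem _ h5

section
variable {A₁ : Matrix (Fin n₁) (Fin m₁) ℝ} {A₂ : Matrix (Fin n₂) (Fin m₂) ℝ}

/-- The linear map induced by an algebra homomorphism on the linear forms. -/
def inducedMap (h₂ : A₂.rank = n₂) (e : ExternalAlgebra A₁ →ₐ[ℝ] ExternalAlgebra A₂) :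
    (Fin n₁ → ℝ) →ₗ[ℝ] (Fin n₂ → ℝ) :=
  TrivSqZeroExt.sndHom ℝ (Fin n₂ → ℝ) ∘ₗ (quotLinearPart h₂).toLinearMap ∘ₗ e.toLinearMap ∘ₗ
    (Ideal.Quotient.mkₐ ℝ (externalIdeal A₁)).toLinearMap ∘ₗ linFormₗ n₁

/-- A linear form is nilpotent, so the constant term of its image is a nilpotent real number, hence
0. This is what makes ungraded homomorphisms tractable. -/
theorem quotLinearPart_map_linForm (h₁ : A₁.rank = n₁) (h₂ : A₂.rank = n₂)
    (e : ExternalAlgebra A₁ →ₐ[ℝ] ExternalAlgebra A₂) (η : Fin n₁ → ℝ) :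
    quotLinearPart h₂ (e (Ideal.Quotient.mk _ (linForm η))) =
      TrivSqZeroExt.inr (inducedMap h₂ e η) := by
  ext1
  · have h := linForm_pow_mem_externalIdeal h₁ η
    rw [← Ideal.Quotient.eq_zero_iff_mem, map_pow] at h
    have h' := congrArg (fun z => (quotLinearPart h₂ (e z)).fst) h
    simp only [map_pow, TrivSqZeroExt.fst_pow, map_zero, TrivSqZeroExt.fst_zero] at h'
    rw [pow_eq_zero_iff (by omega)] at h'
    rw [h', TrivSqZeroExt.fst_inr]
  · rfl

/-- A homomorphism cannot raise the nilpotency index, which is at most `weight + 1` in the source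
and exceeds the weight of the linear part in the target. -/
theorem weight_inducedMap_le (h₁ : A₁.rank = n₁) (h₂ : A₂.rank = n₂)
    (e : ExternalAlgebra A₁ →ₐ[ℝ] ExternalAlgebra A₂) (η : Fin n₁ → ℝ) :
    weight A₂ (inducedMap h₂ e η) ≤ weight A₁ η := by
  obtain ⟨p, hp⟩ := Ideal.Quotient.mk_surjective (e (Ideal.Quotient.mk _ (linForm η)))
  have h := linForm_pow_mem_externalIdeal h₁ η
  rw [← Ideal.Quotient.eq_zero_iff_mem, map_pow] at h
  refine Nat.lt_succ_iff.1 (weight_lt_of_pow_mem (p := p) ?_ (k := weight A₁ η + 1) ?_)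
  · rw [← quotLinearPart_mk h₂, hp, quotLinearPart_map_linForm h₁]
  · rw [← Ideal.Quotient.eq_zero_iff_mem, map_pow, hp, ← map_pow, h, map_zero]

theorem quotLinearPart_algHom (h₁ : A₁.rank = n₁) (h₂ : A₂.rank = n₂)
    (e : ExternalAlgebra A₁ →ₐ[ℝ] ExternalAlgebra A₂) (z : ExternalAlgebra A₁) :
    quotLinearPart h₂ (e z) = TrivSqZeroExt.map (inducedMap h₂ e) (quotLinearPart h₁ z) := by
  obtain ⟨p, rfl⟩ := Ideal.Quotient.mk_surjective z
  have : ((quotLinearPart h₂).comp e).comp (Ideal.Quotient.mkₐ ℝ (externalIdeal A₁)) =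
      ((TrivSqZeroExt.map (inducedMap h₂ e)).comp (quotLinearPart h₁)).comp
        (Ideal.Quotient.mkₐ ℝ (externalIdeal A₁)) := by
    refine MvPolynomial.algHom_ext fun i => ?_
    simp only [AlgHom.comp_apply, Ideal.Quotient.mkₐ_eq_mk, quotLinearPart_mk]
    rw [← linForm_single, quotLinearPart_map_linForm h₁, linearPart_linForm,
      TrivSqZeroExt.map_inr]
  exact AlgHom.congr_fun this p

theorem inducedMap_inducedMap (h₁ : A₁.rank = n₁) (h₂ : A₂.rank = n₂)
    (e : ExternalAlgebra A₁ ≃ₐ[ℝ] ExternalAlgebra A₂) (η : Fin n₁ → ℝ) :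
    inducedMap h₁ e.symm.toAlgHom (inducedMap h₂ e.toAlgHom η) = η := by
  have h := quotLinearPart_algHom h₂ h₁ e.symm.toAlgHom
    (e.toAlgHom (Ideal.Quotient.mk _ (linForm η)))
  rw [quotLinearPart_map_linForm h₁, TrivSqZeroExt.map_inr] at h
  have h0 : e.symm.toAlgHom (e.toAlgHom (Ideal.Quotient.mk _ (linForm η))) =
    Ideal.Quotient.mk _ (linForm η) := e.symm_apply_apply _
  rw [h0, quotLinearPart_mk, linearPart_linForm] at h
  exact (TrivSqZeroExt.inr_injective h).symm

theorem AlgebraIso.weightIso (h₁ : A₁.rank = n₁) (h₂ : A₂.rank = n₂) (h : AlgebraIso A₁ A₂) :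
    WeightIso A₁ A₂ := by
  obtain ⟨e⟩ := h
  refine ⟨LinearEquiv.ofLinearMap (inducedMap h₂ e.toAlgHom) (inducedMap h₁ e.symm.toAlgHom)
    (LinearMap.ext fun η => inducedMap_inducedMap h₂ h₁ e.symm η)
    (LinearMap.ext fun η => inducedMap_inducedMap h₁ h₂ e η), fun η => ?_⟩
  refine le_antisymm (weight_inducedMap_le h₁ h₂ e.toAlgHom η) ?_
  have := weight_inducedMap_le h₂ h₁ e.symm.toAlgHom (inducedMap h₂ e.toAlgHom η)
  rwa [inducedMap_inducedMap h₁ h₂ e η] at this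

end

end

/-! ### Weight isometries, z-equivalence and column matroids. -/

section

section MacWilliams

variable {K V : Type*} [Field K] [AddCommGroup V] [Module K V]

theorem exists_eq_smul_of_ker_le {f g : Module.Dual K V} (hf : f ≠ 0)
    (h : LinearMap.ker g ≤ LinearMap.ker f) : ∃ c : K, c ≠ 0 ∧ f = c • g := by
  have hmem : f ∈ Submodule.span K (Set.range fun _ : Unit => g) :=
    mem_span_of_iInf_ker_le_ker (by simpa using h)
  rw [Set.range_const, Submodule.mem_span_singleton] at hmem
  obtain ⟨c, rfl⟩ := hmem
  exact ⟨c, by rintro rfl; simp at hf, rfl⟩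

theorem ker_eq_of_ker_le {f g : Module.Dual K V} (hf : f ≠ 0)
    (h : LinearMap.ker g ≤ LinearMap.ker f) : LinearMap.ker f = LinearMap.ker g := by
  obtain ⟨c, hc, rfl⟩ := exists_eq_smul_of_ker_le hf h
  exact LinearMap.ker_smul g c hc

/-- Two finite families of nonzero linear forms such that at each point the same number of members
is nonzero agree up to a bijection and nonzero factors. -/
theorem exists_equiv_eq_smul_of_card_eq [Infinite K] {ι κ : Type*} [Fintype ι] [Fintype κ]
    [DecidableEq K]
    (f : ι → Module.Dual K V) (g : κ → Module.Dual K V) (hf : ∀ i, f i ≠ 0) (hg : ∀ k, g k ≠ 0)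
    (h : ∀ x, (Finset.univ.filter fun i => f i x ≠ 0).card =
      (Finset.univ.filter fun k => g k x ≠ 0).card) :
    ∃ (σ : ι ≃ κ) (d : ι → K), ∀ i, d i ≠ 0 ∧ f i = d i • g (σ i) := by
  classical
  have hex : ∀ φ : Module.Dual K V, φ ≠ 0 → ∃ x, φ x ≠ 0 := fun φ hφ => by
    by_contra! hall
    exact hφ (LinearMap.ext hall)
  let s : ι ⊕ κ → Module.Dual K V := Sum.elim f g
  have hs : ∀ a, s a ≠ 0 := Sum.rec hf hg
  have hcard : Fintype.card ι = Fintype.card κ := by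
    -- At a point outside all kernels the hypothesis compares the sizes of the two families.
    obtain ⟨x, hx⟩ := Module.Dual.exists_forall_ne_zero_of_forall_exists s fun a => hex _ (hs a)
    have h' := h x
    have hl : ∀ i ∈ Finset.univ, f i x ≠ 0 := fun i _ => hx (Sum.inl i)
    have hr : ∀ k ∈ Finset.univ, g k x ≠ 0 := fun k _ => hx (Sum.inr k)
    rwa [Finset.filter_true_of_mem hl, Finset.filter_true_of_mem hr] at h'
  have hzero : ∀ x, (Finset.univ.filter fun i => f i x = 0).card =
      (Finset.univ.filter fun k => g k x = 0).card := by
    intro x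
    have h₁ := Finset.card_filter_add_card_filter_not (s := Finset.univ) fun i => f i x = 0
    have h₂ := Finset.card_filter_add_card_filter_not (s := Finset.univ) fun k => g k x = 0
    have h₃ := h x
    rw [Finset.card_univ] at h₁ h₂
    simp only [ne_eq] at h₃
    omega
  have hfib : ∀ H : Submodule K V, Nonempty ({i // LinearMap.ker (f i) = H} ≃
      {k // LinearMap.ker (g k) = H}) := by
    intro H
    by_cases hH : ∃ a, LinearMap.ker (s a) = H
    · obtain ⟨a, rfl⟩ := hH
      -- For a point `x` of the hyperplane `H` outside all other kernels, the forms vanishing at `x`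
      -- are exactly those with kernel `H`, so counting zeros at `x` counts the fibre over `H`.
      obtain ⟨x, hx, hx'⟩ := Module.Dual.exists_forall_mem_ne_zero_of_forall_exists
        (LinearMap.ker (s a))
        (fun b : {b // LinearMap.ker (s b) ≠ LinearMap.ker (s a)} => s b) (by
          rintro ⟨b, hb⟩
          by_contra! hall
          exact hb (ker_eq_of_ker_le (hs b) fun x hx => hall x hx))
      have hiff : ∀ b, LinearMap.ker (s b) = LinearMap.ker (s a) ↔ s b x = 0 := fun b =>
        ⟨fun hb => LinearMap.mem_ker.1 (hb ▸ hx), fun hb => by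
          by_contra hne
          exact hx' ⟨b, hne⟩ hb⟩
      rw [← Fintype.card_eq, Fintype.card_subtype, Fintype.card_subtype]
      have hl : ∀ i ∈ Finset.univ, LinearMap.ker (f i) = LinearMap.ker (s a) ↔ f i x = 0 :=
        fun i _ => hiff (Sum.inl i)
      have hr : ∀ k ∈ Finset.univ, LinearMap.ker (g k) = LinearMap.ker (s a) ↔ g k x = 0 :=
        fun k _ => hiff (Sum.inr k)
      rw [Finset.filter_congr hl, Finset.filter_congr hr]
      exact hzero x
    · push Not at hH
      have : IsEmpty {i // LinearMap.ker (f i) = H} := ⟨fun i => hH (Sum.inl i) i.2⟩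
      have : IsEmpty {k // LinearMap.ker (g k) = H} := ⟨fun k => hH (Sum.inr k) k.2⟩
      exact ⟨Equiv.equivOfIsEmpty _ _⟩
  let e := fun H => (hfib H).some
  have hσ : ∀ i, LinearMap.ker (g (Equiv.ofFiberEquiv e i)) = LinearMap.ker (f i) :=
    Equiv.ofFiberEquiv_map e
  choose d hd using fun i => exists_eq_smul_of_ker_le (hf i) (hσ i).le
  exact ⟨Equiv.ofFiberEquiv e, d, hd⟩

end MacWilliams

variable {n m n₁ m₁ n₂ m₂ : ℕ} {A₁ : Matrix (Fin n₁) (Fin m₁) ℝ} {A₂ : Matrix (Fin n₂) (Fin m₂) ℝ}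

/-- The columns of the matrices agree up to a linear isomorphism, a permutation and nonzero
factors. -/
def ColumnEquiv (A₁ : Matrix (Fin n₁) (Fin m₁) ℝ) (A₂ : Matrix (Fin n₂) (Fin m₂) ℝ) : Prop :=
  ∃ (σ : Fin m₁ ≃ Fin m₂) (d : Fin m₁ → ℝ) (ψ : (Fin n₁ → ℝ) ≃ₗ[ℝ] (Fin n₂ → ℝ)),
    (∀ j, d j ≠ 0) ∧ ∀ η j, Matrix.vecMul η A₁ j = Matrix.vecMul (ψ η) A₂ (σ j) * d j

theorem WeightIso.columnEquiv (hc₁ : ∀ j, A₁.col j ≠ 0) (hc₂ : ∀ j, A₂.col j ≠ 0)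
    (h : WeightIso A₁ A₂) : ColumnEquiv A₁ A₂ := by
  obtain ⟨ψ, hψ⟩ := h
  obtain ⟨σ, d, hd⟩ := exists_equiv_eq_smul_of_card_eq (K := ℝ) (V := Fin n₁ → ℝ)
    (fun j => LinearMap.proj j ∘ₗ Matrix.vecMulLinear A₁)
    (fun j => LinearMap.proj j ∘ₗ Matrix.vecMulLinear A₂ ∘ₗ ψ.toLinearMap)
    (fun j h => hc₁ j (dotProduct_self_eq_zero.1 (LinearMap.congr_fun h (A₁.col j))))
    (fun j h => hc₂ j (dotProduct_self_eq_zero.1 (by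
      have := LinearMap.congr_fun h (ψ.symm (A₂.col j))
      simpa [vecMul_apply] using this)))
    (fun η => by
      have := hψ η
      rw [weight_eq_card, weight_eq_card] at this
      exact this.symm)
  refine ⟨σ, d, ψ, fun j => (hd j).1, fun η j => ?_⟩
  rw [mul_comm]
  exact LinearMap.congr_fun (hd j).2 η

theorem ColumnEquiv.weightIso (h : ColumnEquiv A₁ A₂) : WeightIso A₁ A₂ := by
  obtain ⟨σ, d, ψ, hd, h⟩ := h
  refine ⟨ψ, fun η => ?_⟩
  rw [weight_eq_card, weight_eq_card]
  refine (Finset.card_equiv σ fun j => ?_).symm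
  simp [h η j, hd j]

theorem mem_span_row {A : Matrix (Fin n) (Fin m) ℝ} {v : Fin m → ℝ} :
    v ∈ Submodule.span ℝ (Set.range A.row) ↔ ∃ η, Matrix.vecMul η A = v := by
  rw [← range_vecMulLinear]
  rfl

theorem ColumnEquiv.zEquiv (h : ColumnEquiv A₁ A₂) : ZEquiv A₁ A₂ := by
  obtain ⟨σ, d, ψ, hd, h⟩ := h
  refine ⟨σ, d, hd, fun v => ?_⟩
  rw [mem_span_row]
  constructor
  · rintro ⟨η, rfl⟩
    exact ⟨_, mem_span_row.2 ⟨ψ η, rfl⟩, h η⟩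
  · rintro ⟨w, hw, hv⟩
    obtain ⟨θ, rfl⟩ := mem_span_row.1 hw
    refine ⟨ψ.symm θ, funext fun j => ?_⟩
    rw [h, hv, ψ.apply_symm_apply]

theorem ZEquiv.columnEquiv (h₁ : A₁.rank = n₁) (h₂ : A₂.rank = n₂) (h : ZEquiv A₁ A₂) :
    ColumnEquiv A₁ A₂ := by
  obtain ⟨σ, d, hd, h⟩ := h
  let T : (Fin m₁ → ℝ) →ₗ[ℝ] (Fin m₂ → ℝ) :=
    { toFun := fun v k => v (σ.symm k) / d (σ.symm k)
      map_add' := fun v w => funext fun k => add_div _ _ _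
      map_smul' := fun c v => funext fun k => mul_div_assoc _ _ _ }
  have hT : ∀ v j, T v (σ j) * d j = v j := fun v j => by simp [T, hd j]
  let f : (Fin n₁ → ℝ) →ₗ[ℝ] (Fin m₂ → ℝ) := T ∘ₗ Matrix.vecMulLinear A₁
  have hf : Function.Injective f := fun η θ hηθ => vecMul_injective h₁ (funext fun j => by
    have := congrArg (fun w => w (σ j) * d j) hηθ
    simpa [f, hT] using this)
  have hrange : LinearMap.range f = LinearMap.range (Matrix.vecMulLinear A₂) := by
    ext w
    constructor
    · rintro ⟨η, rfl⟩
      obtain ⟨w, hw, hw'⟩ := (h (Matrix.vecMul η A₁)).1 (mem_span_row.2 ⟨η, rfl⟩)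
      obtain ⟨θ, rfl⟩ := mem_span_row.1 hw
      refine ⟨θ, funext fun k => ?_⟩
      have := hw' (σ.symm k)
      rw [Equiv.apply_symm_apply] at this
      simp [f, T, this, hd]
    · rintro ⟨θ, rfl⟩
      obtain ⟨η, hη⟩ := mem_span_row.1 ((h fun j => Matrix.vecMul θ A₂ (σ j) * d j).2
        ⟨_, mem_span_row.2 ⟨θ, rfl⟩, fun _ => rfl⟩)
      refine ⟨η, funext fun k => ?_⟩
      simp [f, T, hη, hd]
  let ψ := (LinearEquiv.ofInjective f hf).trans ((LinearEquiv.ofEq _ _ hrange).trans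
    (LinearEquiv.ofInjective (Matrix.vecMulLinear A₂) (vecMul_injective h₂)).symm)
  have hψ : ∀ η, Matrix.vecMul (ψ η) A₂ = f η := fun η => by
    have : LinearEquiv.ofInjective (Matrix.vecMulLinear A₂) (vecMul_injective h₂) (ψ η) =
      LinearEquiv.ofEq _ _ hrange (LinearEquiv.ofInjective f hf η) := by simp [ψ]
    exact congrArg Subtype.val this
  refine ⟨σ, d, ψ, hd, fun η j => ?_⟩
  rw [hψ]
  exact (hT _ j).symm

theorem columnMatroid_indep (A : Matrix (Fin n) (Fin m) ℝ) (I : Set (Fin m)) :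
    (columnMatroid A).Indep I ↔ LinearIndepOn ℝ A.col I := Iff.rfl

/-- The ground set of the column matroid consists of all columns. -/
def groundEquiv (A : Matrix (Fin n) (Fin m) ℝ) : (columnMatroid A).E ≃ Fin m where
  toFun := Subtype.val
  invFun j := ⟨j, trivial⟩
  left_inv _ := rfl
  right_inv _ := rfl

theorem matroidIso_columnMatroid_iff {α : Type*} {M : Matroid α} {A : Matrix (Fin n) (Fin m) ℝ} :
    MatroidIso M (columnMatroid A) ↔ ∃ e : M.E ≃ Fin m, ∀ I : Set M.E,
      M.Indep (Subtype.val '' I) ↔ LinearIndepOn ℝ A.col (e '' I) := by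
  constructor
  · rintro ⟨e, he⟩
    refine ⟨e.trans (groundEquiv A), fun I => ?_⟩
    rw [he, columnMatroid_indep, Equiv.coe_trans, Set.image_comp]
    rfl
  · rintro ⟨e, he⟩
    refine ⟨e.trans (groundEquiv A).symm, fun I => ?_⟩
    rw [he, columnMatroid_indep, Equiv.coe_trans, Set.image_comp, Set.image_image Subtype.val]
    change _ ↔ LinearIndepOn ℝ A.col ((fun x => x) '' (e '' I))
    rw [Set.image_id']

theorem matroidIso_columnMatroid_columnMatroid_iff :
    MatroidIso (columnMatroid A₁) (columnMatroid A₂) ↔ ∃ σ : Fin m₁ ≃ Fin m₂,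
      ∀ I : Set (Fin m₁), LinearIndepOn ℝ A₁.col I ↔ LinearIndepOn ℝ A₂.col (σ '' I) := by
  rw [matroidIso_columnMatroid_iff]
  constructor
  · rintro ⟨e, he⟩
    refine ⟨(groundEquiv A₁).symm.trans e, fun I => ?_⟩
    have := he ((groundEquiv A₁).symm '' I)
    rw [columnMatroid_indep, Set.image_image] at this
    rw [Equiv.coe_trans, Set.image_comp, ← this]
    change _ ↔ LinearIndepOn ℝ A₁.col ((fun x => x) '' I)
    rw [Set.image_id']
  · rintro ⟨σ, h⟩
    refine ⟨(groundEquiv A₁).trans σ, fun I => ?_⟩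
    rw [columnMatroid_indep, h, Equiv.coe_trans, Set.image_comp]
    rfl

theorem ColumnEquiv.matroidIso (h : ColumnEquiv A₁ A₂) :
    MatroidIso (columnMatroid A₁) (columnMatroid A₂) := by
  obtain ⟨σ, d, ψ, hd, h⟩ := h
  refine matroidIso_columnMatroid_columnMatroid_iff.2 ⟨σ, fun I => ?_⟩
  -- The adjoint of `ψ`, which carries the columns of `A₂` to those of `A₁` up to order and nonzero
  -- factors.
  let P := (LinearMap.toMatrix' ψ.toLinearMap).transpose
  have hP : ∀ η a, η ⬝ᵥ P.mulVec a = ψ η ⬝ᵥ a := fun η a => by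
    rw [Matrix.dotProduct_mulVec, Matrix.vecMul_transpose, LinearMap.toMatrix'_mulVec]
    rfl
  have hker : LinearMap.ker P.mulVecLin = ⊥ := by
    rw [LinearMap.ker_eq_bot']
    intro a ha
    have := hP (ψ.symm a) a
    rw [← Matrix.mulVecLin_apply, ha, dotProduct_zero, ψ.apply_symm_apply] at this
    exact dotProduct_self_eq_zero.1 this.symm
  have hcol : ∀ j, A₁.col j = Units.mk0 (d j) (hd j) • P.mulVecLin (A₂.col (σ j)) := fun j => by
    refine dotProduct_eq _ _ fun η => ?_
    rw [dotProduct_comm, ← vecMul_apply, h, dotProduct_comm, Units.smul_mk0, dotProduct_smul,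
      Matrix.mulVecLin_apply, hP, vecMul_apply, smul_eq_mul, mul_comm]
  have h1 : LinearIndepOn ℝ A₁.col I ↔ LinearIndependent ℝ ((fun i : I =>
      Units.mk0 (d i) (hd i)) • fun i : I => P.mulVecLin (A₂.col (σ i))) := by
    rw [LinearIndepOn]
    congr! 1
    exact funext fun i => hcol i
  rw [h1, LinearIndependent.units_smul_iff]
  have h2 := P.mulVecLin.linearIndependent_iff (v := fun i : I => A₂.col (σ i)) hker
  rw [← linearIndepOn_equiv]
  exact h2

end

/-! ### Cauchy–Binet and weighted projectors. -/

section

open Matrix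

/-- The weighted Cauchy–Binet formula for `A D Aᵀ`, summed over all choices of columns. -/
theorem factorial_mul_det_mul_diagonal_mul_transpose {R ι κ : Type*} [CommRing R] [Fintype ι]
    [DecidableEq ι] [Fintype κ] [DecidableEq κ] (A : Matrix ι κ R) (x : κ → R) :
    ((Fintype.card ι).factorial : R) * (A * diagonal x * Aᵀ).det =
      ∑ g : ι → κ, (∏ i, x (g i)) * (A.submatrix id g).det ^ 2 := by
  have h1 : (A * diagonal x * Aᵀ).det =
      ∑ g : ι → κ, (∏ i, A i (g i)) * ((∏ i, x (g i)) * (A.submatrix id g).det) := by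
    have hrow : A * diagonal x * Aᵀ = fun i => ∑ k, (A i k * x k) • Aᵀ k := by
      ext i j
      rw [Matrix.mul_apply]
      simp [Matrix.mul_diagonal]
    change detRowAlternating (A * diagonal x * Aᵀ) = _
    rw [hrow]
    refine (detRowAlternating.toMultilinearMap.map_sum _).trans ?_
    refine Finset.sum_congr rfl fun g _ => ?_
    refine (detRowAlternating.map_smul_univ _ _).trans ?_
    rw [Finset.prod_mul_distrib, smul_eq_mul, mul_assoc, ← det_transpose (A.submatrix id g)]
    rfl
  -- Reindexing `g` by `σ` changes the minor only by a sign. Summing over all `σ` completes the row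
  -- product to a second minor and produces the factorial.
  have h2 : ∀ σ : Equiv.Perm ι, (A * diagonal x * Aᵀ).det = ∑ g : ι → κ,
      (∏ i, A i (g (σ i))) * ((∏ i, x (g i)) * (Equiv.Perm.sign σ * (A.submatrix id g).det)) := by
    intro σ
    rw [h1, ← (Equiv.arrowCongr σ.symm (Equiv.refl κ)).sum_comp]
    refine Finset.sum_congr rfl fun g _ => ?_
    have hp : ∏ i, x (g (σ i)) = ∏ i, x (g i) := Equiv.prod_comp σ fun i => x (g i)
    rw [← det_permute' σ (A.submatrix id g), ← hp]
    rfl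
  have h3 : ((Fintype.card ι).factorial : R) * (A * diagonal x * Aᵀ).det =
      ∑ _σ : Equiv.Perm ι, (A * diagonal x * Aᵀ).det := by
    rw [Finset.sum_const, Finset.card_univ, Fintype.card_perm, nsmul_eq_mul]
  rw [h3, Finset.sum_congr rfl fun σ _ => h2 σ, Finset.sum_comm]
  refine Finset.sum_congr rfl fun g _ => ?_
  have hdet : (A.submatrix id g).det =
      ∑ σ : Equiv.Perm ι, (Equiv.Perm.sign σ : R) * ∏ i, A i (g (σ i)) := by
    rw [← det_transpose, det_apply']
    rfl
  calc _ = (∏ i, x (g i)) * (∑ σ : Equiv.Perm ι, (Equiv.Perm.sign σ : R) * ∏ i, A i (g (σ i))) *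
        (A.submatrix id g).det := by
        rw [Finset.mul_sum, Finset.sum_mul]
        exact Finset.sum_congr rfl fun σ _ => by ring
    _ = _ := by rw [← hdet]; ring

section Projector

variable {n m : ℕ}

/-- The weighted Gram matrix of the rows. -/
def gram (A : Matrix (Fin n) (Fin m) ℝ) (x : Fin m → ℝ) : Matrix (Fin n) (Fin n) ℝ :=
  A * diagonal x * Aᵀ

/-- The (weighted) projector on the row space. -/
def rowProj (A : Matrix (Fin n) (Fin m) ℝ) (x : Fin m → ℝ) : Matrix (Fin m) (Fin m) ℝ :=
  Aᵀ * (gram A x)⁻¹ * A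

theorem gram_transpose (A : Matrix (Fin n) (Fin m) ℝ) (x : Fin m → ℝ) :
    (gram A x)ᵀ = gram A x := by
  simp [gram, Matrix.mul_assoc]

theorem rowProj_transpose (A : Matrix (Fin n) (Fin m) ℝ) (x : Fin m → ℝ) :
    (rowProj A x)ᵀ = rowProj A x := by
  simp [rowProj, Matrix.mul_assoc, transpose_nonsing_inv, gram_transpose]

theorem rowProj_comm (A : Matrix (Fin n) (Fin m) ℝ) (x : Fin m → ℝ) (i j : Fin m) :
    rowProj A x i j = rowProj A x j i := by
  conv_lhs => rw [← rowProj_transpose]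
  rfl

theorem gram_add (A : Matrix (Fin n) (Fin m) ℝ) (x y : Fin m → ℝ) :
    gram A (x + y) = gram A x + gram A y := by
  rw [gram, gram, gram, ← Matrix.add_mul, ← Matrix.mul_add, diagonal_add]
  rfl

theorem gram_sum_single {k : ℕ} (A : Matrix (Fin n) (Fin m) ℝ) (f : Fin k → Fin m) :
    gram A (∑ a, Pi.single (f a) 1) = A.submatrix id f * (A.submatrix id f)ᵀ := by
  ext i j
  rw [gram, Matrix.mul_apply, Matrix.mul_apply]
  simp only [mul_diagonal, transpose_apply, submatrix_apply, id_eq,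
    Finset.sum_apply, Finset.mul_sum, Finset.sum_mul]
  rw [Finset.sum_comm]
  refine Finset.sum_congr rfl fun a _ => ?_
  rw [Finset.sum_eq_single (f a)] <;> simp +contextual

/-- The matrix determinant lemma for a low-rank update: Gram determinants alone determine the
principal minors of `1 + Π`. -/
theorem det_gram_add {k : ℕ} (A : Matrix (Fin n) (Fin m) ℝ) {x : Fin m → ℝ}
    (hx : (gram A x).det ≠ 0) (f : Fin k → Fin m) :
    (gram A (x + ∑ a, Pi.single (f a) 1)).det =
      (gram A x).det * (1 + (rowProj A x).submatrix f f).det := by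
  rw [gram_add, gram_sum_single, det_add_mul _ _ (isUnit_iff_ne_zero.2 hx)]
  rfl

/-- The difference of two projectors. -/
theorem rowProj_sub (A : Matrix (Fin n) (Fin m) ℝ) {x y : Fin m → ℝ}
    (hx : (gram A x).det ≠ 0) (hxy : (gram A (x + y)).det ≠ 0) :
    rowProj A x - rowProj A (x + y) = rowProj A (x + y) * diagonal y * rowProj A x := by
  have h1 := nonsing_inv_mul (gram A (x + y)) (isUnit_iff_ne_zero.2 hxy)
  have h2 := mul_nonsing_inv (gram A x) (isUnit_iff_ne_zero.2 hx)
  have h3 : A * diagonal y * Aᵀ = gram A (x + y) - gram A x := by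
    rw [gram_add, add_sub_cancel_left]
    rfl
  calc rowProj A x - rowProj A (x + y)
      = Aᵀ * ((gram A x)⁻¹ - (gram A (x + y))⁻¹) * A := by
        rw [rowProj, rowProj, Matrix.mul_sub, Matrix.sub_mul]
    _ = Aᵀ * ((gram A (x + y))⁻¹ * (A * diagonal y * Aᵀ) * (gram A x)⁻¹) * A := by
        congr 2
        rw [h3, Matrix.mul_sub, Matrix.sub_mul, h1, Matrix.mul_assoc _ (gram A x), h2,
          Matrix.one_mul, Matrix.mul_one]
    _ = _ := by simp only [rowProj, Matrix.mul_assoc]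

theorem rowProj_sub_apply (A : Matrix (Fin n) (Fin m) ℝ) {x : Fin m → ℝ} {j : Fin m}
    (hx : (gram A x).det ≠ 0) (hxy : (gram A (x + Pi.single j 1)).det ≠ 0) (a b : Fin m) :
    rowProj A x a b - rowProj A (x + Pi.single j 1) a b =
      rowProj A (x + Pi.single j 1) a j * rowProj A x j b := by
  rw [← Matrix.sub_apply, rowProj_sub A hx hxy, mul_apply]
  simp only [mul_diagonal]
  rw [Finset.sum_eq_single j] <;> simp +contextual

/-- The range of the projector is the row space. -/
theorem exists_rowProj_mulVec_eq_iff (A : Matrix (Fin n) (Fin m) ℝ) {x : Fin m → ℝ}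
    (hx : (gram A x).det ≠ 0) (v : Fin m → ℝ) :
    (∃ u, rowProj A x *ᵥ u = v) ↔ ∃ η, η ᵥ* A = v := by
  constructor
  · rintro ⟨u, rfl⟩
    refine ⟨((gram A x)⁻¹ * A) *ᵥ u, ?_⟩
    rw [← mulVec_transpose, mulVec_mulVec, rowProj, Matrix.mul_assoc]
  · rintro ⟨η, rfl⟩
    refine ⟨(diagonal x * Aᵀ) *ᵥ η, ?_⟩
    rw [← mulVec_transpose, mulVec_mulVec, rowProj]
    congr 1
    have h := nonsing_inv_mul (gram A x) (isUnit_iff_ne_zero.2 hx)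
    calc Aᵀ * (gram A x)⁻¹ * A * (diagonal x * Aᵀ)
        = Aᵀ * ((gram A x)⁻¹ * gram A x) := by simp only [gram, Matrix.mul_assoc]
      _ = Aᵀ := by rw [h, Matrix.mul_one]

/-- A real matrix as a matrix of polynomials. -/
def polyMatrix (A : Matrix (Fin n) (Fin m) ℝ) :
    Matrix (Fin n) (Fin m) (MvPolynomial (Fin m) ℝ) :=
  Matrix.of fun i j => MvPolynomial.C (A i j)

/-- The weighted Gram matrix with indeterminate weights. -/
def polyGram (A : Matrix (Fin n) (Fin m) ℝ) : Matrix (Fin n) (Fin n) (MvPolynomial (Fin m) ℝ) :=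
  polyMatrix A * (diagonal fun k => MvPolynomial.X k : Matrix (Fin m) (Fin m) (MvPolynomial (Fin m) ℝ)) *
    (polyMatrix A)ᵀ

/-- The numerators of the entries of the projector with indeterminate weights. -/
def polyProj (A : Matrix (Fin n) (Fin m) ℝ) : Matrix (Fin m) (Fin m) (MvPolynomial (Fin m) ℝ) :=
  (polyMatrix A)ᵀ * (polyGram A).adjugate * polyMatrix A

theorem map_eval_polyMatrix (A : Matrix (Fin n) (Fin m) ℝ) (x : Fin m → ℝ) :
    (polyMatrix A).map (MvPolynomial.eval x) = A := by
  ext i j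
  simp [polyMatrix]

theorem map_eval_polyGram (A : Matrix (Fin n) (Fin m) ℝ) (x : Fin m → ℝ) :
    (polyGram A).map (MvPolynomial.eval x) = gram A x := by
  rw [polyGram, Matrix.map_mul, Matrix.map_mul, transpose_map, map_eval_polyMatrix,
    diagonal_map (map_zero _)]
  simp [gram]

theorem eval_det_polyGram (A : Matrix (Fin n) (Fin m) ℝ) (x : Fin m → ℝ) :
    MvPolynomial.eval x (polyGram A).det = (gram A x).det := by
  rw [RingHom.map_det, RingHom.mapMatrix_apply, map_eval_polyGram]

theorem eval_polyProj (A : Matrix (Fin n) (Fin m) ℝ) {x : Fin m → ℝ} (hx : (gram A x).det ≠ 0)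
    (i j : Fin m) :
    MvPolynomial.eval x (polyProj A i j) = (gram A x).det * rowProj A x i j := by
  have hadj : (polyGram A).adjugate.map (MvPolynomial.eval x) = (gram A x).adjugate := by
    rw [← map_eval_polyGram]
    exact RingHom.map_adjugate _ _
  have h : (polyProj A).map (MvPolynomial.eval x) = (gram A x).det • rowProj A x := by
    rw [polyProj, Matrix.map_mul, Matrix.map_mul, transpose_map, map_eval_polyMatrix, hadj, rowProj,
      inv_def, Ring.inverse_eq_inv', Matrix.mul_smul, Matrix.smul_mul, smul_smul,
      mul_inv_cancel₀ hx, one_smul]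
  exact congrFun (congrFun h i) j

theorem eval_polyProj_ne_zero_iff (A : Matrix (Fin n) (Fin m) ℝ) {x : Fin m → ℝ}
    (hx : (gram A x).det ≠ 0) (i j : Fin m) :
    MvPolynomial.eval x (polyProj A i j) ≠ 0 ↔ rowProj A x i j ≠ 0 := by
  rw [eval_polyProj A hx]
  simp [hx]

theorem det_gram_one_ne_zero {A : Matrix (Fin n) (Fin m) ℝ} (hA : A.rank = n) :
    (gram A 1).det ≠ 0 := by
  rw [Ne, ← exists_mulVec_eq_zero_iff]
  rintro ⟨v, hv, h⟩
  apply hv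
  refine eq_zero_of_vecMul hA fun j => congrFun (?_ : v ᵥ* A = 0) j
  rw [← dotProduct_self_eq_zero]
  have h' := congrArg (v ⬝ᵥ ·) h
  simp only [gram, dotProduct_zero] at h'
  rw [diagonal_one', Matrix.mul_one, ← mulVec_mulVec, dotProduct_mulVec, mulVec_transpose] at h'
  exact h'

theorem exists_eval_ne_zero {p : MvPolynomial (Fin m) ℝ} (hp : p ≠ 0) :
    ∃ x, MvPolynomial.eval x p ≠ 0 := by
  by_contra! h
  exact hp (MvPolynomial.funext fun x => by simp [h x])

theorem det_polyGram_ne_zero {A : Matrix (Fin n) (Fin m) ℝ} (hA : A.rank = n) :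
    (polyGram A).det ≠ 0 := by
  intro h
  apply det_gram_one_ne_zero hA
  rw [← eval_det_polyGram, h, map_zero]

/-- If `Π i k` vanished identically, the rank-one update at `j` would give `Π' i j * Π j k = 0`, so
`Π' i j = 0`; the same formula for the entry `i j` then forces `Π i j = 0`. -/
theorem polyProj_trans {A : Matrix (Fin n) (Fin m) ℝ} (hA : A.rank = n) {i j k : Fin m}
    (hij : polyProj A i j ≠ 0) (hjk : polyProj A j k ≠ 0) : polyProj A i k ≠ 0 := by
  intro hik
  -- The Gram determinant at weights raised by one at `j`, so that a single generic `x` makes both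
  -- Gram matrices invertible.
  let D' := MvPolynomial.aeval (fun l => MvPolynomial.X l +
    MvPolynomial.C ((Pi.single j 1 : Fin m → ℝ) l)) (polyGram A).det
  have hD' : ∀ x, MvPolynomial.eval x D' = (gram A (x + Pi.single j 1)).det := by
    intro x
    rw [← eval_det_polyGram, ← MvPolynomial.coe_aeval_eq_eval, ← MvPolynomial.coe_aeval_eq_eval]
    change ((MvPolynomial.aeval x).comp (MvPolynomial.aeval _)) _ = MvPolynomial.aeval _ _
    rw [MvPolynomial.comp_aeval]
    congr 2
    ext l
    simp
  have hD'0 : D' ≠ 0 := by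
    intro h
    have := hD' (1 - Pi.single j 1)
    rw [h, map_zero, sub_add_cancel] at this
    exact det_gram_one_ne_zero hA this.symm
  obtain ⟨x, hx⟩ := exists_eval_ne_zero
    (mul_ne_zero (mul_ne_zero (det_polyGram_ne_zero hA) hD'0) (mul_ne_zero hij hjk))
  simp only [map_mul, mul_ne_zero_iff, hD', eval_det_polyGram] at hx
  obtain ⟨⟨hx, hx'⟩, h1, h2⟩ := hx
  rw [eval_polyProj_ne_zero_iff A hx] at h1 h2
  have hik1 : rowProj A x i k = 0 := by
    by_contra h
    rw [← Ne, ← eval_polyProj_ne_zero_iff A hx, hik] at h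
    simp at h
  have hik2 : rowProj A (x + Pi.single j 1) i k = 0 := by
    by_contra h
    rw [← Ne, ← eval_polyProj_ne_zero_iff A hx', hik] at h
    simp at h
  have e1 := rowProj_sub_apply A hx hx' i k
  rw [hik1, hik2, sub_zero, zero_eq_mul, or_iff_left h2] at e1
  have e2 := rowProj_sub_apply A hx hx' i j
  rw [e1, sub_zero, zero_mul] at e2
  exact h1 e2

theorem polyProj_comm {A : Matrix (Fin n) (Fin m) ℝ} (hA : A.rank = n) {i j : Fin m}
    (hij : polyProj A i j ≠ 0) : polyProj A j i ≠ 0 := by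
  obtain ⟨x, hx⟩ := exists_eval_ne_zero (mul_ne_zero (det_polyGram_ne_zero hA) hij)
  simp only [map_mul, mul_ne_zero_iff, eval_det_polyGram] at hx
  obtain ⟨hx, h⟩ := hx
  rw [eval_polyProj_ne_zero_iff A hx, rowProj_comm, ← eval_polyProj_ne_zero_iff A hx] at h
  intro h0
  simp [h0] at h

/-- By symmetry and transitivity, a nonzero entry `i j` forces a nonzero diagonal entry. Otherwise
column `i` of `Π` vanishes, and so does column `i` of `A`. -/
theorem polyProj_self {A : Matrix (Fin n) (Fin m) ℝ} (hA : A.rank = n) {i : Fin m}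
    (hi : A.col i ≠ 0) : polyProj A i i ≠ 0 := by
  by_contra h
  have hall : ∀ j, rowProj A 1 j i = 0 := by
    intro j
    by_contra hne
    rw [← Ne, rowProj_comm, ← eval_polyProj_ne_zero_iff A (det_gram_one_ne_zero hA)] at hne
    have hij : polyProj A i j ≠ 0 := fun h0 => hne (by rw [h0, map_zero])
    exact polyProj_trans hA hij (polyProj_comm hA hij) h
  apply hi
  have h1 : (gram A 1)⁻¹ *ᵥ A.col i = 0 := by
    refine eq_zero_of_vecMul hA fun j => ?_
    rw [← hall j, ← mulVec_transpose, mulVec_mulVec]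
    rfl
  have h2 := congrArg (gram A 1 *ᵥ ·) h1
  simpa [mulVec_mulVec, mul_nonsing_inv _ (isUnit_iff_ne_zero.2 (det_gram_one_ne_zero hA))]
    using h2

/-- For generic weights, the relation `Π i j ≠ 0` is an equivalence relation. -/
theorem exists_generic {A : Matrix (Fin n) (Fin m) ℝ} (hA : A.rank = n)
    (hc : ∀ j, A.col j ≠ 0) : ∃ x, (gram A x).det ≠ 0 ∧
      Equivalence fun i j => rowProj A x i j ≠ 0 := by
  classical
  have hprod : ∏ ij ∈ Finset.univ.filter fun ij : Fin m × Fin m => polyProj A ij.1 ij.2 ≠ 0,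
      polyProj A ij.1 ij.2 ≠ 0 :=
    Finset.prod_ne_zero_iff.2 fun ij hij => (Finset.mem_filter.1 hij).2
  obtain ⟨x, hx⟩ := exists_eval_ne_zero (mul_ne_zero (det_polyGram_ne_zero hA) hprod)
  simp only [map_mul, mul_ne_zero_iff, eval_det_polyGram, map_prod, Finset.prod_ne_zero_iff] at hx
  obtain ⟨hx, h⟩ := hx
  have hiff : ∀ i j, rowProj A x i j ≠ 0 ↔ polyProj A i j ≠ 0 := by
    intro i j
    rw [← eval_polyProj_ne_zero_iff A hx]
    exact ⟨fun h0 h1 => h0 (by rw [h1, map_zero]), fun h0 => h (i, j) (by simp [h0])⟩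
  refine ⟨x, hx, fun i => (hiff i i).2 (polyProj_self hA (hc i)), fun {i j} hij => ?_,
    fun {i j k} hij hjk => ?_⟩
  · rwa [rowProj_comm]
  · rw [hiff] at *
    exact polyProj_trans hA hij hjk

end Projector

/-- Two symmetric real matrices with the same principal minors of size at most three are
conjugate by a signed diagonal matrix if the nonvanishing of the entries is an equivalence
relation. -/
theorem exists_signs {ι : Type*} (P Q : ι → ι → ℝ) (hP : ∀ i j, P i j = P j i)
    (hQ : ∀ i j, Q i j = Q j i) (h2 : ∀ i j, P i j ^ 2 = Q i j ^ 2)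
    (h3 : ∀ i j k, P i j * P j k * P k i = Q i j * Q j k * Q k i)
    (heq : Equivalence fun i j => P i j ≠ 0) :
    ∃ d : ι → ℝ, (∀ i, d i * d i = 1) ∧ ∀ i j, Q i j = d i * P i j * d j := by
  let s : Setoid ι := ⟨_, heq⟩
  -- Each class gets a root; the sign at `i` compares the entries joining `i` to its root, and the
  -- triangle on the root, `i` and `j` settles the entry `i j`.
  let r : ι → ι := fun i => (Quotient.mk s i).out
  have hr : ∀ i, P (r i) i ≠ 0 := fun i => Quotient.mk_out (s := s) i
  have hd : ∀ i, Q (r i) i / P (r i) i * (Q (r i) i / P (r i) i) = 1 := by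
    intro i
    have := h2 (r i) i
    have := hr i
    field_simp
    linarith
  refine ⟨fun i => Q (r i) i / P (r i) i, hd, fun i j => ?_⟩
  by_cases hij : P i j = 0
  · have := h2 i j
    rw [hij] at this
    have : Q i j = 0 := by simpa using this.symm
    simp [hij, this]
  · have hrr : r i = r j := congrArg Quotient.out (Quotient.sound (s := s) hij)
    have h := h3 (r i) i j
    have hi := hr i
    have hj := hr j
    have hi2 := h2 (r i) i
    have hj2 := h2 (r j) j
    change Q i j = Q (r i) i / P (r i) i * P i j * (Q (r j) j / P (r j) j)
    rw [← hrr] at hj hj2 ⊢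
    rw [hP j, hQ j] at h
    field_simp
    have hQi : Q (r i) i ≠ 0 := fun h0 => hi (by rw [h0] at hi2; simpa using hi2)
    have hQj : Q (r i) j ≠ 0 := fun h0 => hj (by rw [h0] at hj2; simpa using hj2)
    apply mul_left_cancel₀ (mul_ne_zero hQi hQj)
    linear_combination (-P (r i) i * P (r i) j) * h + P i j * P (r i) j ^ 2 * hi2
      + P i j * Q (r i) i ^ 2 * hj2

end

/-! ### Unimodular matrices and regular matroids. -/

open Matrix

variable {n m n₁ m₁ n₂ m₂ : ℕ}

theorem det_submatrix_ne_zero_iff (A : Matrix (Fin n) (Fin m) ℝ) (g : Fin n → Fin m) :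
    (A.submatrix id g).det ≠ 0 ↔ LinearIndependent ℝ (A.col ∘ g) := by
  rw [← isUnit_iff_ne_zero, ← isUnit_iff_isUnit_det, ← linearIndependent_cols_iff_isUnit]
  rfl

theorem linearIndependent_col_comp_iff (A : Matrix (Fin n) (Fin m) ℝ) (g : Fin n → Fin m) :
    LinearIndependent ℝ (A.col ∘ g) ↔
      Function.Injective g ∧ LinearIndepOn ℝ A.col (Set.range g) := by
  constructor
  · intro h
    have hg : Function.Injective g := h.injective.of_comp
    exact ⟨hg, (linearIndepOn_range_iff hg _).2 h⟩
  · rintro ⟨hg, h⟩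
    exact (linearIndepOn_range_iff hg _).1 h

theorem IsUnimodular.det_sq {A : Matrix (Fin n) (Fin m) ℝ} (hA : IsUnimodular A)
    (g : Fin n → Fin m) [Decidable ((A.submatrix id g).det = 0)] :
    (A.submatrix id g).det ^ 2 = if (A.submatrix id g).det = 0 then 0 else 1 := by
  split_ifs with h
  · simp [h]
  · obtain ⟨s, hs⟩ := hA g
    rw [← hs] at h ⊢
    rcases s with _ | _ | _ <;> simp at h ⊢

/-- The weighted Gram determinant of a unimodular matrix depends only on its matroid. -/
theorem det_gram_eq {A B : Matrix (Fin n) (Fin m) ℝ} (hA : IsUnimodular A) (hB : IsUnimodular B)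
    (h : ∀ I, LinearIndepOn ℝ A.col I ↔ LinearIndepOn ℝ B.col I) (x : Fin m → ℝ) :
    (gram A x).det = (gram B x).det := by
  classical
  have hfac : ((Fintype.card (Fin n)).factorial : ℝ) ≠ 0 := by
    exact_mod_cast Nat.factorial_ne_zero _
  apply mul_left_cancel₀ hfac
  rw [gram, gram, factorial_mul_det_mul_diagonal_mul_transpose,
    factorial_mul_det_mul_diagonal_mul_transpose]
  refine Finset.sum_congr rfl fun g _ => ?_
  -- Squared maximal minors are indicators of bases, hence matroid data.
  rw [hA.det_sq, hB.det_sq]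
  have : (A.submatrix id g).det = 0 ↔ (B.submatrix id g).det = 0 := by
    rw [← not_iff_not, ← Ne, ← Ne, det_submatrix_ne_zero_iff, det_submatrix_ne_zero_iff,
      linearIndependent_col_comp_iff, linearIndependent_col_comp_iff, h]
  simp only [this]

/-- Unimodular matrices with the same matroid have the same row space up to signs of the
coordinates. -/
theorem exists_signs_rowSpace {A B : Matrix (Fin n) (Fin m) ℝ} (hA : IsUnimodular A)
    (hB : IsUnimodular B) (hr : A.rank = n) (hc : ∀ j, A.col j ≠ 0)
    (h : ∀ I, LinearIndepOn ℝ A.col I ↔ LinearIndepOn ℝ B.col I) :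
    ∃ d : Fin m → ℝ, (∀ j, d j * d j = 1) ∧
      ∀ v : Fin m → ℝ, (∃ η, η ᵥ* A = v) ↔ ∃ η, η ᵥ* B = fun j => d j * v j := by
  obtain ⟨x, hx, heq⟩ := exists_generic hr hc
  have hdet := det_gram_eq hA hB h
  have hxB : (gram B x).det ≠ 0 := hdet x ▸ hx
  have hminor : ∀ {k : ℕ} (f : Fin k → Fin m), (1 + (rowProj A x).submatrix f f).det =
      (1 + (rowProj B x).submatrix f f).det := by
    intro k f
    apply mul_left_cancel₀ hx
    rw [← det_gram_add A hx, hdet, det_gram_add B hxB, hdet]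
  have h1 : ∀ i, rowProj A x i i = rowProj B x i i := fun i => by
    have := hminor ![i]
    simp only [det_fin_one, Matrix.add_apply, submatrix_apply, Matrix.one_apply] at this
    simpa using this
  have h2 : ∀ i j, rowProj A x i j ^ 2 = rowProj B x i j ^ 2 := fun i j => by
    have := hminor ![i, j]
    simp only [det_fin_two, Matrix.add_apply, submatrix_apply, Matrix.one_apply] at this
    simp [h1, rowProj_comm A x j i, rowProj_comm B x j i] at this
    linarith
  have h3 : ∀ i j k, rowProj A x i j * rowProj A x j k * rowProj A x k i =
      rowProj B x i j * rowProj B x j k * rowProj B x k i := fun i j k => by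
    have := hminor ![i, j, k]
    simp only [det_fin_three, Matrix.add_apply, submatrix_apply, Matrix.one_apply] at this
    simp [h1, rowProj_comm A x j i, rowProj_comm B x j i, rowProj_comm A x k j,
      rowProj_comm B x k j, rowProj_comm A x i k, rowProj_comm B x i k] at this
    have hij := h2 i j
    have hjk := h2 j k
    have hki := h2 k i
    -- A symmetric 3 × 3 determinant contains the triangle product twice; its other terms involve
    -- only diagonal entries and squares.
    linear_combination this / 2 + (1 + rowProj B x k k) / 2 * hij + (1 + rowProj B x i i) / 2 * hjk
      + (1 + rowProj B x j j) / 2 * hki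
  obtain ⟨d, hd, hAB⟩ := exists_signs (rowProj A x) (rowProj B x) (rowProj_comm A x)
    (rowProj_comm B x) h2 h3 heq
  have hmul : ∀ u, rowProj B x *ᵥ (fun j => d j * u j) = fun j => d j * (rowProj A x *ᵥ u) j := by
    intro u
    ext i
    simp only [mulVec, dotProduct, Finset.mul_sum]
    refine Finset.sum_congr rfl fun j _ => ?_
    rw [hAB]
    linear_combination d i * rowProj A x i j * u j * hd j
  refine ⟨d, hd, fun v => ?_⟩
  rw [← exists_rowProj_mulVec_eq_iff A hx, ← exists_rowProj_mulVec_eq_iff B hxB]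
  constructor
  · rintro ⟨u, rfl⟩
    exact ⟨_, hmul u⟩
  · rintro ⟨u, hu⟩
    refine ⟨fun j => d j * u j, funext fun j => ?_⟩
    have h4 := congrFun (hmul fun j => d j * u j) j
    simp only [← mul_assoc, hd, one_mul] at h4
    have h5 := congrFun hu j
    have hdj : d j ≠ 0 := fun h0 => by simpa [h0] using hd j
    exact mul_left_cancel₀ hdj (h4.symm.trans h5)

theorem exists_det_submatrix_ne_zero {A : Matrix (Fin n) (Fin m) ℝ} (hA : A.rank = n) :
    ∃ g : Fin n → Fin m, (A.submatrix id g).det ≠ 0 := by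
  have h := Submodule.exists_fun_fin_finrank_span_eq ℝ (Set.range A.col)
  rw [← rank_eq_finrank_span_cols, hA] at h
  obtain ⟨f, hf, _, hli⟩ := h
  choose g hg using hf
  refine ⟨g, (det_submatrix_ne_zero_iff A g).2 ?_⟩
  rwa [show A.col ∘ g = f from funext hg]

theorem rank_le_of_matroid {A₁ : Matrix (Fin n₁) (Fin m₁) ℝ} {A₂ : Matrix (Fin n₂) (Fin m₂) ℝ}
    (h₁ : A₁.rank = n₁) (σ : Fin m₁ ≃ Fin m₂)
    (h : ∀ I : Set (Fin m₁), LinearIndepOn ℝ A₁.col I → LinearIndepOn ℝ A₂.col (σ '' I)) :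
    n₁ ≤ n₂ := by
  obtain ⟨g, hg⟩ := exists_det_submatrix_ne_zero h₁
  rw [det_submatrix_ne_zero_iff, linearIndependent_col_comp_iff] at hg
  have h' := h _ hg.2
  rw [← Set.range_comp, linearIndepOn_range_iff (σ.injective.comp hg.1)] at h'
  simpa using h'.fintype_card_le_finrank

theorem zEquiv_of_matroidIso {A₁ : Matrix (Fin n₁) (Fin m₁) ℝ} {A₂ : Matrix (Fin n₂) (Fin m₂) ℝ}
    (hu₁ : IsUnimodular A₁) (hu₂ : IsUnimodular A₂) (h₁ : A₁.rank = n₁) (h₂ : A₂.rank = n₂)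
    (hc₁ : ∀ j, A₁.col j ≠ 0)
    (h : MatroidIso (columnMatroid A₁) (columnMatroid A₂)) : ZEquiv A₁ A₂ := by
  obtain ⟨σ, hσ⟩ := matroidIso_columnMatroid_columnMatroid_iff.1 h
  obtain rfl : n₁ = n₂ := le_antisymm (rank_le_of_matroid h₁ σ fun I => (hσ I).1)
    (rank_le_of_matroid h₂ σ.symm fun I hI => (hσ _).2 (by simpa using hI))
  -- Permuting the columns of `A₂` by `σ` makes the two matroids equal.
  obtain ⟨d, hd, hdv⟩ := exists_signs_rowSpace (B := A₂.submatrix id σ) hu₁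
    (fun g => by simpa using hu₂ (σ ∘ g)) h₁ hc₁ (fun I => by
      rw [hσ, ← linearIndepOn_equiv]
      rfl)
  have hd0 : ∀ j, d j ≠ 0 := fun j h0 => by simpa [h0] using hd j
  refine ⟨σ, d, hd0, fun v => ?_⟩
  rw [mem_span_row, hdv]
  constructor
  · rintro ⟨η, hη⟩
    refine ⟨η ᵥ* A₂, mem_span_row.2 ⟨η, rfl⟩, fun j => ?_⟩
    have : (η ᵥ* A₂) (σ j) = d j * v j := congrFun hη j
    rw [this]
    linear_combination (-v j) * hd j
  · rintro ⟨w, hw, hv⟩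
    obtain ⟨η, rfl⟩ := mem_span_row.1 hw
    refine ⟨η, funext fun j => ?_⟩
    change (η ᵥ* A₂) (σ j) = d j * v j
    rw [hv]
    linear_combination (-(η ᵥ* A₂) (σ j)) * hd j

/-- A unimodular matrix that contains the unit matrix is totally unimodular. -/
theorem IsUnimodular.isTotallyUnimodular {B : Matrix (Fin n) (Fin m) ℝ} (hB : IsUnimodular B)
    {β : Fin n → Fin m} (hβ : B.submatrix id β = 1) : B.IsTotallyUnimodular := by
  classical
  intro k f g hf _
  let e : Fin k ⊕ {i // i ∉ Set.range f} ≃ Fin n :=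
    ((Equiv.ofInjective f hf).sumCongr (Equiv.refl _)).trans (Equiv.Set.sumCompl (Set.range f))
  have hel : ∀ a, e (Sum.inl a) = f a := fun a => rfl
  have her : ∀ c, e (Sum.inr c) = c.1 := fun c => rfl
  -- The minor is completed to a maximal one by the unit columns of the missing rows; the result is
  -- block triangular with the same determinant.
  let h : Fin n → Fin m := fun i => Sum.elim g (fun c => β c.1) (e.symm i)
  have hhl : ∀ a, h (f a) = g a := fun a =>
    congrArg (Sum.elim g fun c => β c.1) (e.symm_apply_apply (Sum.inl a))
  have hhr : ∀ c : {i // i ∉ Set.range f}, h c.1 = β c.1 := fun c =>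
    congrArg (Sum.elim g fun c => β c.1) (e.symm_apply_apply (Sum.inr c))
  have hdet : (B.submatrix id h).det = (B.submatrix f g).det := by
    rw [← det_submatrix_equiv_self e]
    have hblock : (B.submatrix id h).submatrix e e = fromBlocks (B.submatrix f g) 0
        (B.submatrix (fun c : {i // i ∉ Set.range f} => c.1) g) 1 := by
      ext (a | c) (b | c')
      · simp [hhl, hel]
      · have := congrFun (congrFun hβ (f a)) c'.1
        rw [submatrix_apply, one_apply_ne fun hne => c'.2 ⟨a, hne⟩] at this
        simpa [hhr, hel, her] using this
      · simp [hhl, her, hel]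
      · have := congrFun (congrFun hβ c.1) c'.1
        simpa [hhr, her, one_apply, Subtype.ext_iff] using this
    rw [hblock, det_fromBlocks_zero₁₂, det_one, mul_one]
  rw [← hdet]
  exact hB h

/-- Left multiplication by the inverse of a basis submatrix, of determinant ±1, keeps unimodularity
and the matroid and creates a unit submatrix. -/
theorem IsUnimodular.isRegularMatroid {A : Matrix (Fin n) (Fin m) ℝ} (hA : IsUnimodular A)
    (hr : A.rank = n) : IsRegularMatroid (columnMatroid A) := by
  obtain ⟨g, hg⟩ := exists_det_submatrix_ne_zero hr
  set M := A.submatrix id g with hM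
  have hunit : IsUnit M.det := isUnit_iff_ne_zero.2 hg
  have hinv : M.det⁻¹ ∈ Set.range (SignType.cast : SignType → ℝ) := by
    obtain ⟨s, hs⟩ := hA g
    refine ⟨s, ?_⟩
    rw [hM, ← hs]
    rcases s with _ | _ | _ <;> simp
  have hB : IsUnimodular (M⁻¹ * A) := by
    intro h
    have : (M⁻¹ * A).submatrix id h = M⁻¹ * A.submatrix id h := rfl
    rw [this, det_mul, det_nonsing_inv, Ring.inverse_eq_inv']
    obtain ⟨s, hs⟩ := hinv
    obtain ⟨t, ht⟩ := hA h
    exact ⟨s * t, by rw [← hs, ← ht, SignType.coe_mul]⟩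
  refine ⟨n, m, M⁻¹ * A, hB.isTotallyUnimodular (β := g) (nonsing_inv_mul M hunit),
    matroidIso_columnMatroid_columnMatroid_iff.2 ⟨Equiv.refl _, fun I => ?_⟩⟩
  rw [Equiv.coe_refl, Set.image_id]
  refine (LinearMap.linearIndepOn_iff_of_injOn (M⁻¹).mulVecLin
    (Function.Injective.injOn fun u v huv => ?_)).symm
  have := congrArg (M *ᵥ ·) huv
  simpa [mulVec_mulVec, mul_nonsing_inv M hunit] using this

theorem columnMatroid_loopless {A : Matrix (Fin n) (Fin m) ℝ} (hc : ∀ j, A.col j ≠ 0) :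
    (columnMatroid A).Loopless := by
  rw [Matroid.loopless_iff_forall_isNonloop]
  intro j _
  rw [← Matroid.indep_singleton, columnMatroid_indep, linearIndepOn_singleton_iff]
  exact hc j

/-- A basis of the row space consisting of rows gives a matrix of full row rank with the same
matroid. -/
theorem exists_rows_rank_eq (B : Matrix (Fin n) (Fin m) ℝ) :
    ∃ (r : ℕ) (ρ : Fin r → Fin n), (B.submatrix ρ id).rank = r ∧
      ∀ I, LinearIndepOn ℝ (B.submatrix ρ id).col I ↔ LinearIndepOn ℝ B.col I := by
  obtain ⟨f, hf, hspan, hli⟩ := Submodule.exists_fun_fin_finrank_span_eq ℝ (Set.range B.row)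
  choose ρ hρ using hf
  have hrow : (B.submatrix ρ id).row = f := funext hρ
  refine ⟨_, ρ, by rw [LinearIndependent.rank_matrix (by rwa [hrow]), Fintype.card_fin],
    fun I => ?_⟩
  refine LinearMap.linearIndepOn_iff_of_injOn (v := B.col) (s := I)
    (LinearMap.funLeft ℝ ℝ ρ) ?_
  have hle : Submodule.span ℝ (B.col '' I) ≤ LinearMap.range B.mulVecLin := by
    rw [range_mulVecLin]
    exact Submodule.span_mono (Set.image_subset_range _ _)
  rintro _ hu _ hv huv
  obtain ⟨u, rfl⟩ := hle hu
  obtain ⟨v, rfl⟩ := hle hv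
  rw [← sub_eq_zero, ← map_sub] at huv ⊢
  rw [← map_sub] at huv
  set c := u - v
  -- Forgetting the other rows is injective on the column space: if `B c` vanishes on a row basis,
  -- `c` is orthogonal to every row.
  have hker : Submodule.span ℝ (Set.range B.row) ≤
      LinearMap.ker ((dotProductBilin ℝ ℝ).flip c : (Fin m → ℝ) →ₗ[ℝ] ℝ) := by
    rw [← hspan, Submodule.span_le]
    rintro _ ⟨a, rfl⟩
    rw [← hρ a]
    exact congrFun huv a
  ext i
  exact hker (Submodule.subset_span ⟨i, rfl⟩)

theorem IsRegularMatroid.exists_isTotallyUnimodular {α : Type*} {M : Matroid α}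
    (hM : IsRegularMatroid M) (hl : M.Loopless) :
    ∃ (n m : ℕ) (A : Matrix (Fin n) (Fin m) ℝ), A.IsTotallyUnimodular ∧ A.rank = n ∧
      (∀ j, A.col j ≠ 0) ∧ MatroidIso M (columnMatroid A) := by
  obtain ⟨n, m, B, hB, hiso⟩ := hM
  obtain ⟨e, he⟩ := matroidIso_columnMatroid_iff.1 hiso
  obtain ⟨r, ρ, hr, hI⟩ := exists_rows_rank_eq B
  refine ⟨r, m, B.submatrix ρ id, hB.submatrix ρ id, hr, fun j => ?_,
    matroidIso_columnMatroid_iff.2 ⟨e, fun I => by rw [he, hI]⟩⟩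
  rw [← linearIndepOn_singleton_iff ℝ, hI]
  have h := (he {e.symm j}).1 (by
    rw [Set.image_singleton, Matroid.indep_singleton]
    exact Matroid.isNonloop_of_loopless (e.symm j).2)
  simpa using h

end Zonotopal

end

theorem theorem2p6 :
    (∀ (n₁ m₁ n₂ m₂ : ℕ) (A₁ : Matrix (Fin n₁) (Fin m₁) ℝ) (A₂ : Matrix (Fin n₂) (Fin m₂) ℝ),
      Zonotopal.IsUnimodular A₁ → Zonotopal.IsUnimodular A₂ →
      A₁.rank = n₁ → A₂.rank = n₂ →
      (∀ j, A₁.col j ≠ 0) → (∀ j, A₂.col j ≠ 0) →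
      List.TFAE [
        Zonotopal.AlgebraIso A₁ A₂,
        Zonotopal.GradedAlgebraIso A₁ A₂,
        Zonotopal.ZEquiv A₁ A₂,
        Zonotopal.MatroidIso (Zonotopal.columnMatroid A₁) (Zonotopal.columnMatroid A₂)]) ∧
    (∀ (n m : ℕ) (A : Matrix (Fin n) (Fin m) ℝ),
      Zonotopal.IsUnimodular A → A.rank = n → (∀ j, A.col j ≠ 0) →
      Zonotopal.IsRegularMatroid (Zonotopal.columnMatroid A) ∧
        (Zonotopal.columnMatroid A).Loopless) ∧
    (∀ (α : Type*) (M : Matroid α), Zonotopal.IsRegularMatroid M → M.Loopless →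
      ∃ (n m : ℕ) (A : Matrix (Fin n) (Fin m) ℝ),
        A.IsTotallyUnimodular ∧ A.rank = n ∧ (∀ j, A.col j ≠ 0) ∧
        Zonotopal.MatroidIso M (Zonotopal.columnMatroid A)) := by
  refine ⟨fun n₁ m₁ n₂ m₂ A₁ A₂ hu₁ hu₂ h₁ h₂ hc₁ hc₂ => ?_,
    fun n m A hA hr hc => ⟨hA.isRegularMatroid hr, Zonotopal.columnMatroid_loopless hc⟩,
    fun α M hM hl => hM.exists_isTotallyUnimodular hl⟩
  tfae_have 2 → 1 := Zonotopal.GradedAlgebraIso.algebraIso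
  tfae_have 1 → 3 := fun h => ((h.weightIso h₁ h₂).columnEquiv hc₁ hc₂).zEquiv
  tfae_have 3 → 2 := fun h => (h.columnEquiv h₁ h₂).weightIso.gradedAlgebraIso h₁ h₂
  tfae_have 3 → 4 := fun h => (h.columnEquiv h₁ h₂).matroidIso
  tfae_have 4 → 3 := Zonotopal.zEquiv_of_matroidIso hu₁ hu₂ h₁ h₂ hc₁
  tfae_finish
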